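/- Let $p\ge 0$ and let $G\subset GL(p,\mathbb{R})$ be a connected linear Lie group, i.e. a connected (immersed, not necessarily closed) Lie subgroup, with Lie algebra $\mathfrak g=T_IG\subset M_p(\mathbb{R})$. All germs are $C^\infty$ and are taken at $0\in\mathbb{R}^p$. Define: - $\theta[G]_0(p)$ is the real vector space of germs of vector fields $\eta=\sum_{i=1}^p\eta_i(y)\,\partial/\partial y_i$ on $(\mathbb{R}^p,0)$ with $\eta(0)=0$ and $\big(\partial\eta_i/\partial y_j(y)\big)_{i,j}\in\mathfrak g$ for all $y$ near $0$. - $\mathrm{Diff}[G](p)$ is the set of diffeomorphism germs $\psi:(\mathbb{R}^p,0)\to(\mathbb{R}^p,0)$ whose Jacobi matrix $J_\psi(y)$ lies in $G$ for all $y$ near $0$. - $\mathrm{Diff}_0[G](p)$ is the set of those $\psi\in\mathrm{Diff}[G](p)$ that are isotopic to the identity in $\mathrm{Diff}[G](p)$: there is a $C^\infty$ map $\Psi$ from a neighbourhood of $\{0\}\times[0,1]$ in $\mathbb{R}^p\times\mathbb{R}$ to $\mathbb{R}^p$ such that the germ $\psi_t$ of $\Psi(\cdot,t)$ at $0$ lies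 in $\mathrm{Diff}[G](p)$ for every $t\in[0,1]$, $\psi_0$ is the identity germ and $\psi_1=\psi$. Then the following three conditions are equivalent: 1. $\mathfrak g\cong\theta[G]_0(p)$ as real vector spaces; 2. for every $\eta=\sum_{i=1}^p\eta_i\,\partial/\partial y_i\in\theta[G]_0(p)$, each component $\eta_i$ is (the germ of) a linear function; 3. $\mathrm{Diff}_0[G](p)=G$, where $A\in G$ is identified with the germ at $0$ of the linear map $y\mapsto Ay$. -/

import Mathlib

open Filter Topology Set
open scoped ContDiff Manifold

noncomputable section

namespace GDiff

/-- The set of the matrices that belong to a subgroup `G` of `GL(p, ℝ)`. -/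
def matrixSet {p : ℕ} (G : Subgroup (GL (Fin p) ℝ)) : Set (Matrix (Fin p) (Fin p) ℝ) :=
  {M | ∃ A ∈ G, (A : Matrix (Fin p) (Fin p) ℝ) = M}

/-- `G ⊂ GL(p, ℝ)` is a connected linear Lie group: it is the image of a connected real Lie group
`H` under an injective group homomorphism which is a smooth immersion (into the space of
matrices, written through the matrix entries). Every connected closed subgroup, with its subspace
topology, is of this kind; being closed is not required. -/
def IsConnectedLinearLieGroup {p : ℕ} (G : Subgroup (GL (Fin p) ℝ)) : Prop :=
  ∃ (d : ℕ) (H : Type) (_ : Group H) (_ : TopologicalSpace H)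
    (_ : ChartedSpace (EuclideanSpace ℝ (Fin d)) H) (_ : LieGroup (𝓡 d) ∞ H)
    (_ : ConnectedSpace H) (φ : H →* GL (Fin p) ℝ),
    φ.range = G ∧
    Function.Injective φ ∧
    ContMDiff (𝓡 d) 𝓘(ℝ, Fin p → Fin p → ℝ) ∞
      (fun h : H => fun i j => (φ h : Matrix (Fin p) (Fin p) ℝ) i j) ∧
    ∀ h : H, Function.Injective
      (mfderiv (𝓡 d) 𝓘(ℝ, Fin p → Fin p → ℝ)
        (fun h : H => fun i j => (φ h : Matrix (Fin p) (Fin p) ℝ) i j) h)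

/-- The Lie algebra `𝔤 = T_I G ⊂ M_p(ℝ)`: the velocities at time `0` of the smooth curves of
matrices, defined near `0`, which stay in `G` and start at the identity matrix. -/
def lieAlg {p : ℕ} (G : Subgroup (GL (Fin p) ℝ)) :
    Submodule ℝ (Matrix (Fin p) (Fin p) ℝ) where
  carrier := {X | ∃ c : ℝ → Matrix (Fin p) (Fin p) ℝ,
    c 0 = 1 ∧
    (∀ᶠ t in 𝓝 (0 : ℝ), c t ∈ matrixSet G ∧ ∀ i j, ContDiffAt ℝ ∞ (fun s => c s i j) t) ∧
    ∀ i j, HasDerivAt (fun s => c s i j) (X i j) 0}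
  zero_mem' := by
    refine ⟨fun _ => 1, rfl, Eventually.of_forall fun t => ⟨⟨1, G.one_mem, rfl⟩, fun i j => ?_⟩,
      fun i j => ?_⟩
    · exact contDiffAt_const
    · exact hasDerivAt_const _ _
  add_mem' := by
    rintro X Y ⟨c, hc0, hc, hcX⟩ ⟨e, he0, he, heY⟩
    refine ⟨fun t => c t * e t, by simp [hc0, he0], ?_, fun i j => ?_⟩
    · filter_upwards [hc, he] with t ⟨⟨A, hA, hAc⟩, hct⟩ ⟨⟨B, hB, hBe⟩, het⟩
      refine ⟨⟨A * B, G.mul_mem hA hB, by simp [hAc, hBe]⟩, fun i j => ?_⟩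
      simp only [Matrix.mul_apply]
      exact ContDiffAt.sum fun k _ => (hct i k).mul (het k j)
    · have h := HasDerivAt.fun_sum (u := Finset.univ)
        (fun (k : Fin p) _ => (hcX i k).mul (heY k j))
      have h2 : X i j + Y i j = ∑ k, (X i k * e 0 k j + c 0 i k * Y k j) := by
        simp [hc0, he0, Matrix.one_apply, Finset.sum_add_distrib]
      have h3 : (fun s => (c s * e s) i j) = fun s => ∑ k, c s i k * e s k j := by
        funext s
        exact Matrix.mul_apply
      rw [Matrix.add_apply, h2]
      rw [h3]
      exact h
  smul_mem' := by
    rintro a X ⟨c, hc0, hc, hcX⟩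
    have hm : ContDiff ℝ ∞ (fun t : ℝ => a * t) := contDiff_const.mul contDiff_id
    have ht : Tendsto (fun t : ℝ => a * t) (𝓝 0) (𝓝 0) := by
      have := hm.continuous.tendsto 0
      simpa using this
    refine ⟨fun t => c (a * t), by simp [hc0], ?_, fun i j => ?_⟩
    · filter_upwards [ht.eventually hc] with t ⟨h1, h2⟩
      exact ⟨h1, fun i j => (h2 i j).comp t hm.contDiffAt⟩
    · have h1 : HasDerivAt (fun t : ℝ => a * t) a 0 := by
        simpa using (hasDerivAt_id (0 : ℝ)).const_mul a
      have h2 : HasDerivAt (fun s => c s i j) (X i j) (a * 0) := by simpa using hcX i j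
      have h3 := h2.comp (0 : ℝ) h1
      simpa [Function.comp_def, mul_comm] using h3

/-- The Jacobi matrix `(∂ f_i / ∂ y_j)(y)`. -/
def jacobian {p : ℕ} (f : (Fin p → ℝ) → (Fin p → ℝ)) (y : Fin p → ℝ) :
    Matrix (Fin p) (Fin p) ℝ :=
  LinearMap.toMatrix' (fderiv ℝ f y : (Fin p → ℝ) →ₗ[ℝ] (Fin p → ℝ))

/-- Germs at the origin of maps `ℝ^p → ℝ^p`. A germ of a vector field `∑ η_i ∂/∂y_i` is
identified with the germ of the map `(η_1, …, η_p)`. -/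
abbrev MapGerm (p : ℕ) : Type := Germ (𝓝 (0 : Fin p → ℝ)) (Fin p → ℝ)

/-- `θ[G](p)`: the germs of smooth vector fields whose Jacobi matrix lies in `𝔤` at all points near
the origin. -/
def theta {p : ℕ} (G : Subgroup (GL (Fin p) ℝ)) : Submodule ℝ (MapGerm p) where
  carrier := {η | ∃ f : (Fin p → ℝ) → (Fin p → ℝ), (f : MapGerm p) = η ∧
    ∀ᶠ y in 𝓝 (0 : Fin p → ℝ), ContDiffAt ℝ ∞ f y ∧ jacobian f y ∈ lieAlg G}
  zero_mem' := by
    refine ⟨fun _ => 0, rfl, Eventually.of_forall fun y => ⟨contDiffAt_const, ?_⟩⟩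
    simp [jacobian]
  add_mem' := by
    rintro _ _ ⟨f, rfl, hf⟩ ⟨g, rfl, hg⟩
    refine ⟨f + g, rfl, ?_⟩
    filter_upwards [hf, hg] with y ⟨hf1, hf2⟩ ⟨hg1, hg2⟩
    refine ⟨hf1.add hg1, ?_⟩
    have h := fderiv_add (hf1.differentiableAt (by simp)) (hg1.differentiableAt (by simp))
    simpa [jacobian, h] using (lieAlg G).add_mem hf2 hg2
  smul_mem' := by
    rintro a _ ⟨f, rfl, hf⟩
    refine ⟨a • f, rfl, ?_⟩
    filter_upwards [hf] with y ⟨hf1, hf2⟩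
    refine ⟨contDiffAt_const.smul hf1, ?_⟩
    have h := fderiv_const_smul (hf1.differentiableAt (by simp)) a
    simpa [jacobian, h] using (lieAlg G).smul_mem a hf2

/-- `θ[G]_0(p)`: the elements of `θ[G](p)` that vanish at the origin. -/
def theta0 {p : ℕ} (G : Subgroup (GL (Fin p) ℝ)) : Submodule ℝ (MapGerm p) :=
  theta G ⊓ LinearMap.ker (Germ.valueₗ : MapGerm p →ₗ[ℝ] (Fin p → ℝ))

/-- `f` represents a diffeomorphism germ `(ℝ^p, 0) → (ℝ^p, 0)`: it is smooth near `0`, fixes `0`,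
and has a local inverse with the same properties. -/
def IsDiffeoGerm {p : ℕ} (f : (Fin p → ℝ) → (Fin p → ℝ)) : Prop :=
  f 0 = 0 ∧ (∀ᶠ y in 𝓝 (0 : Fin p → ℝ), ContDiffAt ℝ ∞ f y) ∧
  ∃ g : (Fin p → ℝ) → (Fin p → ℝ),
    g 0 = 0 ∧ (∀ᶠ y in 𝓝 (0 : Fin p → ℝ), ContDiffAt ℝ ∞ g y) ∧
    (∀ᶠ y in 𝓝 (0 : Fin p → ℝ), g (f y) = y) ∧
    ∀ᶠ y in 𝓝 (0 : Fin p → ℝ), f (g y) = y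

/-- `Diff[G](p)`: the diffeomorphism germs whose Jacobi matrix lies in `G` at all points near the
origin. -/
def DiffG {p : ℕ} (G : Subgroup (GL (Fin p) ℝ)) : Set (MapGerm p) :=
  {ψ | ∃ f : (Fin p → ℝ) → (Fin p → ℝ), (f : MapGerm p) = ψ ∧ IsDiffeoGerm f ∧
    ∀ᶠ y in 𝓝 (0 : Fin p → ℝ), jacobian f y ∈ matrixSet G}

/-- `ψ` is isotopic to the identity within `Diff[G](p)`: there is a family `Ψ`, smooth on a
neighbourhood of `{0} × [0,1]`, such that `ψ_t = Ψ(·, t)` represents an element of `Diff[G](p)` for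
all `t ∈ [0,1]`, `ψ_0` is the identity germ and `ψ_1 = ψ`. -/
def IsIsotopicToId {p : ℕ} (G : Subgroup (GL (Fin p) ℝ)) (ψ : MapGerm p) : Prop :=
  ∃ Ψ : (Fin p → ℝ) × ℝ → (Fin p → ℝ),
    (∀ᶠ q in 𝓝ˢ (({0} : Set (Fin p → ℝ)) ×ˢ Icc (0 : ℝ) 1), ContDiffAt ℝ ∞ Ψ q) ∧
    (∀ t ∈ Icc (0 : ℝ) 1, ((fun y => Ψ (y, t) : (Fin p → ℝ) → (Fin p → ℝ)) : MapGerm p) ∈ DiffG G) ∧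
    ((fun y => Ψ (y, 0) : (Fin p → ℝ) → (Fin p → ℝ)) : MapGerm p) =
      ((fun y => y : (Fin p → ℝ) → (Fin p → ℝ)) : MapGerm p) ∧
    ((fun y => Ψ (y, 1) : (Fin p → ℝ) → (Fin p → ℝ)) : MapGerm p) = ψ

/-- `Diff_0[G](p)`: the elements of `Diff[G](p)` isotopic to the identity. -/
def Diff0G {p : ℕ} (G : Subgroup (GL (Fin p) ℝ)) : Set (MapGerm p) :=
  {ψ | ψ ∈ DiffG G ∧ IsIsotopicToId G ψ}

/-- The germ at the origin of the linear map `ψ_A(y) = A y`. -/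
def linGerm {p : ℕ} (A : GL (Fin p) ℝ) : MapGerm p :=
  ((fun y => (A : Matrix (Fin p) (Fin p) ℝ).mulVec y : (Fin p → ℝ) → (Fin p → ℝ)) : MapGerm p)

end GDiff

end

/-! All three conditions are equivalent to the vanishing of the first prolongation of 𝔤, the space
of symmetric bilinear maps B with B(v, ·) ∈ 𝔤 for every v (`ProlongationEqZero`).

For (1) and (2): linear fields embed 𝔤 in θ[G]_0, so by a dimension count any abstract isomorphism
forces this embedding to be onto. The second derivative of a field in θ[G]_0 lies in the
prolongation at each point near 0; conversely, a nonzero B in the prolongation gives the nonlinear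
field y ↦ B(y, y), with Jacobian 2B(y, ·) ∈ 𝔤.

For (3): if f' takes values in G, then f''(y)(v)·f'(y)⁻¹ ∈ 𝔤, and composing both arguments of f''(y)
with f'(y)⁻¹ gives an element of the prolongation. Its vanishing makes all of Diff[G] linear
(`ProlongationEqZero.diffG_subset`), while every A ∈ G is isotopic to the identity because smooth
paths in G join it to 1. Conversely, the flow of y ↦ B(y, y) is an isotopy in Diff[G], and it is not
linear at small nonzero times unless B = 0 (`exists_quadratic_flow`).

The hard point is that the Jacobians of this flow lie in G, which need not be closed. They solve M'
= aM with a ∈ 𝔤, so it must be shown that such solutions stay in G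
(`LocalParam.exists_forall_ode_mem`). This requires velocities of curves smooth in the matrix space
to be tangent to the immersed group (`LocalParam.exists_fderiv_eq_of_mem_lieAlgCLM`), which follows
from a Baire category argument. -/

noncomputable section

namespace GDiff

variable {p : ℕ}

/-! ### Matrices, G and 𝔤 as endomorphisms, where derivatives take their values. -/

/-- The matrix of a continuous endomorphism of `ℝ^p`. -/
def clmMatrix (p : ℕ) :
    ((Fin p → ℝ) →L[ℝ] (Fin p → ℝ)) ≃ₗ[ℝ] Matrix (Fin p) (Fin p) ℝ :=
  LinearMap.toContinuousLinearMap.symm ≪≫ₗ LinearMap.toMatrix'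

/-- The endomorphism with prescribed matrix entries, as a continuous linear equivalence. -/
def entriesCLM (p : ℕ) :
    (Fin p → Fin p → ℝ) ≃L[ℝ] ((Fin p → ℝ) →L[ℝ] (Fin p → ℝ)) :=
  ((Matrix.ofLinearEquiv ℝ).trans (clmMatrix p).symm).toContinuousLinearEquiv

lemma clmMatrix_apply (L : (Fin p → ℝ) →L[ℝ] (Fin p → ℝ)) (i j : Fin p) :
    clmMatrix p L i j = L (Pi.single j 1) i := by
  simp [clmMatrix, LinearMap.toMatrix'_apply]

lemma clmMatrix_mul (L M : (Fin p → ℝ) →L[ℝ] (Fin p → ℝ)) :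
    clmMatrix p (L * M) = clmMatrix p L * clmMatrix p M :=
  LinearMap.toMatrix'_comp _ _

lemma clmMatrix_one : clmMatrix p 1 = 1 := LinearMap.toMatrix'_id

lemma clmMatrix_mulVec (L : (Fin p → ℝ) →L[ℝ] (Fin p → ℝ)) (y : Fin p → ℝ) :
    (clmMatrix p L).mulVec y = L y :=
  LinearMap.toMatrix'_mulVec _ _

lemma clmMatrix_symm_eq (M : Matrix (Fin p) (Fin p) ℝ) :
    (clmMatrix p).symm M = entriesCLM p (fun i j => M i j) := rfl

lemma entriesCLM_clmMatrix (L : (Fin p → ℝ) →L[ℝ] (Fin p → ℝ)) :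
    entriesCLM p (fun i j => clmMatrix p L i j) = L :=
  (clmMatrix p).symm_apply_apply _

/-- The elements of `G`, as endomorphisms of `ℝ^p`. -/
def clmSet (G : Subgroup (GL (Fin p) ℝ)) : Set ((Fin p → ℝ) →L[ℝ] (Fin p → ℝ)) :=
  {L | clmMatrix p L ∈ matrixSet G}

/-- The Lie algebra of `G`, as a space of endomorphisms of `ℝ^p`. -/
def lieAlgCLM (G : Subgroup (GL (Fin p) ℝ)) :
    Submodule ℝ ((Fin p → ℝ) →L[ℝ] (Fin p → ℝ)) :=
  (lieAlg G).comap (clmMatrix p).toLinearMap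

lemma mem_lieAlgCLM {G : Subgroup (GL (Fin p) ℝ)} {L : (Fin p → ℝ) →L[ℝ] (Fin p → ℝ)} :
    L ∈ lieAlgCLM G ↔ clmMatrix p L ∈ lieAlg G := Iff.rfl

/-- The endomorphism given by an invertible matrix. -/
def glCLM (A : GL (Fin p) ℝ) : (Fin p → ℝ) →L[ℝ] (Fin p → ℝ) :=
  (clmMatrix p).symm (A : Matrix (Fin p) (Fin p) ℝ)

lemma clmMatrix_glCLM (A : GL (Fin p) ℝ) :
    clmMatrix p (glCLM A) = (A : Matrix (Fin p) (Fin p) ℝ) :=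
  (clmMatrix p).apply_symm_apply _

lemma glCLM_mul (A B : GL (Fin p) ℝ) : glCLM (A * B) = glCLM A * glCLM B := by
  apply (clmMatrix p).injective
  simp [clmMatrix_mul, clmMatrix_glCLM]

lemma glCLM_one : glCLM (1 : GL (Fin p) ℝ) = 1 := by
  apply (clmMatrix p).injective
  simp [clmMatrix_one, clmMatrix_glCLM]

lemma glCLM_mul_inv (A : GL (Fin p) ℝ) : glCLM A * glCLM A⁻¹ = 1 := by
  rw [← glCLM_mul, mul_inv_cancel, glCLM_one]

lemma glCLM_inv_mul (A : GL (Fin p) ℝ) : glCLM A⁻¹ * glCLM A = 1 := by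
  rw [← glCLM_mul, inv_mul_cancel, glCLM_one]

lemma mem_clmSet {G : Subgroup (GL (Fin p) ℝ)} {L : (Fin p → ℝ) →L[ℝ] (Fin p → ℝ)} :
    L ∈ clmSet G ↔ ∃ A ∈ G, glCLM A = L := by
  constructor
  · rintro ⟨A, hA, h⟩
    exact ⟨A, hA, (clmMatrix p).injective (by rw [clmMatrix_glCLM, h])⟩
  · rintro ⟨A, hA, rfl⟩
    exact ⟨A, hA, (clmMatrix_glCLM A).symm⟩

lemma mul_mem_clmSet {G : Subgroup (GL (Fin p) ℝ)} {L M : (Fin p → ℝ) →L[ℝ] (Fin p → ℝ)}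
    (hL : L ∈ clmSet G) (hM : M ∈ clmSet G) : L * M ∈ clmSet G := by
  obtain ⟨A, hA, rfl⟩ := mem_clmSet.1 hL
  obtain ⟨B, hB, rfl⟩ := mem_clmSet.1 hM
  exact mem_clmSet.2 ⟨A * B, G.mul_mem hA hB, glCLM_mul A B⟩

lemma linGerm_eq (A : GL (Fin p) ℝ) :
    linGerm A = ((fun y => glCLM A y : (Fin p → ℝ) → (Fin p → ℝ)) : MapGerm p) := by
  unfold linGerm
  simp only [← clmMatrix_mulVec, clmMatrix_glCLM]

/-- Velocities of curves of endomorphisms which stay in `G`. -/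
lemma mem_lieAlgCLM_of_curve {G : Subgroup (GL (Fin p) ℝ)}
    {c : ℝ → (Fin p → ℝ) →L[ℝ] (Fin p → ℝ)} {X : (Fin p → ℝ) →L[ℝ] (Fin p → ℝ)}
    (h0 : c 0 = 1) (hc : ∀ᶠ t in 𝓝 (0 : ℝ), c t ∈ clmSet G ∧ ContDiffAt ℝ ∞ c t)
    (hX : HasDerivAt c X 0) : X ∈ lieAlgCLM G := by
  let e : Fin p → Fin p → ((Fin p → ℝ) →L[ℝ] (Fin p → ℝ)) →L[ℝ] ℝ := fun i j =>
    (ContinuousLinearMap.proj (R := ℝ) (φ := fun _ : Fin p => ℝ) i).comp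
      (ContinuousLinearMap.apply ℝ (Fin p → ℝ) (Pi.single j 1 : Fin p → ℝ))
  have he : ∀ i j L, e i j L = clmMatrix p L i j := fun i j L => (clmMatrix_apply L i j).symm
  refine ⟨fun t => clmMatrix p (c t), by simp [h0, clmMatrix_one], ?_, fun i j => ?_⟩
  · filter_upwards [hc] with t ht
    refine ⟨ht.1, fun i j => ?_⟩
    simp_rw [← he]
    exact (e i j).contDiff.contDiffAt.comp t ht.2
  · simp_rw [← he]
    exact (e i j).hasFDerivAt.comp_hasDerivAt 0 hX

/-- Every element of the Lie algebra is the velocity of a curve of endomorphisms in `G`. -/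
lemma exists_curve_of_mem_lieAlgCLM {G : Subgroup (GL (Fin p) ℝ)}
    {X : (Fin p → ℝ) →L[ℝ] (Fin p → ℝ)} (hX : X ∈ lieAlgCLM G) :
    ∃ c : ℝ → (Fin p → ℝ) →L[ℝ] (Fin p → ℝ), c 0 = 1 ∧
      (∀ᶠ t in 𝓝 (0 : ℝ), c t ∈ clmSet G ∧ ContDiffAt ℝ ∞ c t) ∧ HasDerivAt c X 0 := by
  obtain ⟨c, h0, hc, hd⟩ := hX
  refine ⟨fun t => (clmMatrix p).symm (c t), ?_, ?_, ?_⟩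
  · simp only [h0, ← clmMatrix_one, LinearEquiv.symm_apply_apply]
  · filter_upwards [hc] with t ht
    refine ⟨?_, ?_⟩
    · change clmMatrix p ((clmMatrix p).symm (c t)) ∈ matrixSet G
      rw [LinearEquiv.apply_symm_apply]
      exact ht.1
    · simp only [clmMatrix_symm_eq]
      exact (entriesCLM p).contDiff.contDiffAt.comp t
        (contDiffAt_pi.2 fun i => contDiffAt_pi.2 fun j => ht.2 i j)
  · have h := (entriesCLM p).hasFDerivAt.comp_hasDerivAt (0 : ℝ)
      (hasDerivAt_pi.2 fun i => hasDerivAt_pi.2 fun j => hd i j)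
    rw [← entriesCLM_clmMatrix X]
    exact h

/-! ### Derivatives with values in a subspace, and germs with zero second derivative. -/

/-- A submodule of a finite-dimensional normed space is the kernel of a continuous map. -/
lemma exists_clm_ker_eq {V : Type*} [NormedAddCommGroup V] [NormedSpace ℝ V]
    [FiniteDimensional ℝ V] (S : Submodule ℝ V) :
    ∃ π : V →L[ℝ] V, ∀ v, π v = 0 ↔ v ∈ S := by
  obtain ⟨T, hT⟩ := S.exists_isCompl
  refine ⟨LinearMap.toContinuousLinearMap (T.subtype ∘ₗ T.projectionOnto S hT.symm), fun v => ?_⟩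
  simp

/-- A linear map with kernel S kills F near y, hence also kills its derivative. -/
lemma fderiv_mem_of_eventually_mem {U V : Type*} [NormedAddCommGroup U] [NormedSpace ℝ U]
    [NormedAddCommGroup V] [NormedSpace ℝ V] [FiniteDimensional ℝ V] {S : Submodule ℝ V}
    {F : U → V} {y : U} (hd : DifferentiableAt ℝ F y) (h : ∀ᶠ z in 𝓝 y, F z ∈ S) (v : U) :
    fderiv ℝ F y v ∈ S := by
  obtain ⟨π, hπ⟩ := exists_clm_ker_eq S
  have h1 : (fun z => π (F z)) =ᶠ[𝓝 y] fun _ => 0 := by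
    filter_upwards [h] with z hz using (hπ _).2 hz
  have h2 := (π.hasFDerivAt.comp y hd.hasFDerivAt).unique
    ((hasFDerivAt_const (0 : V) y).congr_of_eventuallyEq h1)
  rw [← hπ]
  exact congrArg (fun L => L v) h2

/-- A germ with vanishing second derivative is linear. -/
lemma eventuallyEq_fderiv_of_fderiv_fderiv_eq_zero {U V : Type*} [NormedAddCommGroup U]
    [NormedSpace ℝ U] [NormedAddCommGroup V] [NormedSpace ℝ V] {f : U → V} (h0 : f 0 = 0)
    (hf : ∀ᶠ y in 𝓝 (0 : U), DifferentiableAt ℝ f y)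
    (hf' : ∀ᶠ y in 𝓝 (0 : U), DifferentiableAt ℝ (fderiv ℝ f) y)
    (h2 : ∀ᶠ y in 𝓝 (0 : U), fderiv ℝ (fderiv ℝ f) y = 0) :
    f =ᶠ[𝓝 0] fun y => fderiv ℝ f 0 y := by
  obtain ⟨r, hr, hb⟩ := Metric.eventually_nhds_iff_ball.1 (hf.and (hf'.and h2))
  have hmem : (0 : U) ∈ Metric.ball (0 : U) r := Metric.mem_ball_self hr
  -- Constancy on a ball is used twice: for the derivative of f, then for the difference between f
  -- and its linear part.
  have key : ∀ y ∈ Metric.ball (0 : U) r, fderiv ℝ f y = fderiv ℝ f 0 := fun y hy =>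
    Metric.isOpen_ball.is_const_of_fderiv_eq_zero (convex_ball (0 : U) r).isPreconnected
      (fun z hz => (hb z hz).2.1.differentiableWithinAt) (fun z hz => (hb z hz).2.2) hy hmem
  filter_upwards [Metric.ball_mem_nhds (0 : U) hr] with y hy
  have h3 := Metric.isOpen_ball.is_const_of_fderiv_eq_zero (𝕜 := ℝ)
    (f := fun z => f z - fderiv ℝ f 0 z)
    (convex_ball (0 : U) r).isPreconnected
    (fun z hz => ((hb z hz).1.sub (fderiv ℝ f 0).differentiableAt).differentiableWithinAt)
    (fun z hz => by
      rw [fderiv_fun_sub (hb z hz).1 (fderiv ℝ f 0).differentiableAt,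
        ContinuousLinearMap.fderiv, key z hz, sub_self]; rfl) hy hmem
  simpa [h0, sub_eq_zero] using h3

/-! ### Linear fields and the first prolongation. -/

/-- The first prolongation of the Lie algebra of `G` vanishes. -/
def ProlongationEqZero (G : Subgroup (GL (Fin p) ℝ)) : Prop :=
  ∀ B : (Fin p → ℝ) →L[ℝ] (Fin p → ℝ) →L[ℝ] (Fin p → ℝ),
    (∀ u v, B u v = B v u) → (∀ v, B v ∈ lieAlgCLM G) → B = 0

lemma mem_theta0_iff {G : Subgroup (GL (Fin p) ℝ)} {η : MapGerm p} :
    η ∈ theta0 G ↔ ∃ f : (Fin p → ℝ) → (Fin p → ℝ), (f : MapGerm p) = η ∧ f 0 = 0 ∧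
      ∀ᶠ y in 𝓝 (0 : Fin p → ℝ), ContDiffAt ℝ ∞ f y ∧ fderiv ℝ f y ∈ lieAlgCLM G := by
  constructor
  · rintro ⟨⟨f, rfl, hf⟩, h0⟩
    exact ⟨f, rfl, h0, hf⟩
  · rintro ⟨f, rfl, h0, hf⟩
    exact ⟨⟨f, rfl, hf⟩, h0⟩

/-- The linear vector field attached to an element of the Lie algebra. -/
def linearField (G : Subgroup (GL (Fin p) ℝ)) : lieAlg G →ₗ[ℝ] theta0 G where
  toFun X := ⟨((fun y => (clmMatrix p).symm X.1 y : (Fin p → ℝ) → (Fin p → ℝ)) : MapGerm p),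
    mem_theta0_iff.2 ⟨_, rfl, map_zero _, Eventually.of_forall fun y =>
      ⟨((clmMatrix p).symm X.1).contDiff.contDiffAt, by
        rw [ContinuousLinearMap.fderiv, mem_lieAlgCLM, LinearEquiv.apply_symm_apply]
        exact X.2⟩⟩⟩
  map_add' X Y := by
    apply Subtype.ext
    simp only [Submodule.coe_add, map_add]
    rfl
  map_smul' a X := by
    apply Subtype.ext
    simp only [Submodule.coe_smul, map_smul]
    rfl

lemma eventuallyEq_linear {U V : Type*} [NormedAddCommGroup U] [NormedSpace ℝ U]
    [NormedAddCommGroup V] [NormedSpace ℝ V] {L M : U →L[ℝ] V}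
    (h : (L : U → V) =ᶠ[𝓝 0] M) : L = M := by
  rw [← L.fderiv (x := 0), h.fderiv_eq, M.fderiv]

lemma linearField_injective (G : Subgroup (GL (Fin p) ℝ)) :
    Function.Injective (linearField G) := by
  intro X Y h
  have h1 := congrArg Subtype.val h
  have h2 := eventuallyEq_linear (Germ.coe_eq.1 h1)
  exact Subtype.ext ((clmMatrix p).symm.injective h2)

/-- All components of the fields in `θ[G]_0(p)` are linear. -/
def AllFieldsLinear (G : Subgroup (GL (Fin p) ℝ)) : Prop :=
  ∀ η ∈ theta0 G, ∀ i : Fin p, ∃ ℓ : (Fin p → ℝ) →ₗ[ℝ] ℝ,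
    Filter.Germ.map (fun v : Fin p → ℝ => v i) η =
      ((fun y => ℓ y : (Fin p → ℝ) → ℝ) : Filter.Germ (𝓝 (0 : Fin p → ℝ)) ℝ)

lemma AllFieldsLinear.exists_clm {G : Subgroup (GL (Fin p) ℝ)} (h : AllFieldsLinear G)
    {f : (Fin p → ℝ) → (Fin p → ℝ)} (hf : (f : MapGerm p) ∈ theta0 G) :
    ∃ L : (Fin p → ℝ) →L[ℝ] (Fin p → ℝ), f =ᶠ[𝓝 0] L := by
  choose ℓ hℓ using h _ hf
  refine ⟨ContinuousLinearMap.pi fun i => LinearMap.toContinuousLinearMap (ℓ i), ?_⟩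
  have h1 : ∀ i, ∀ᶠ y in 𝓝 (0 : Fin p → ℝ), f y i = ℓ i y := fun i => Germ.coe_eq.1 (hℓ i)
  filter_upwards [eventually_all.2 h1] with y hy
  funext i
  simpa using hy i

lemma allFieldsLinear_iff_surjective (G : Subgroup (GL (Fin p) ℝ)) :
    AllFieldsLinear G ↔ Function.Surjective (linearField G) := by
  constructor
  · rintro h ⟨η, hη⟩
    obtain ⟨f, rfl, -, hf⟩ := mem_theta0_iff.1 hη
    obtain ⟨L, hL⟩ := h.exists_clm hη
    have hmem : L ∈ lieAlgCLM G := by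
      have := hf.self_of_nhds.2
      rwa [hL.fderiv_eq, L.fderiv] at this
    refine ⟨⟨clmMatrix p L, hmem⟩, Subtype.ext ?_⟩
    refine Germ.coe_eq.2 ?_
    simp only [LinearEquiv.symm_apply_apply]
    exact hL.symm
  · intro h η hη i
    obtain ⟨X, hX⟩ := h ⟨η, hη⟩
    have hX' := congrArg Subtype.val hX
    dsimp only at hX'
    rw [← hX']
    exact ⟨LinearMap.proj i ∘ₗ ((clmMatrix p).symm X.1).toLinearMap, rfl⟩

/-- Any isomorphism makes θ[G]_0 finite-dimensional of the dimension of 𝔤, so the injective map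
`linearField` is then onto. -/
lemma allFieldsLinear_iff_nonempty_equiv (G : Subgroup (GL (Fin p) ℝ)) :
    Nonempty (lieAlg G ≃ₗ[ℝ] theta0 G) ↔ AllFieldsLinear G := by
  rw [allFieldsLinear_iff_surjective]
  constructor
  · rintro ⟨e⟩
    have : FiniteDimensional ℝ (theta0 G) := e.finiteDimensional
    exact (LinearMap.injective_iff_surjective_of_finrank_eq_finrank e.finrank_eq).1
      (linearField_injective G)
  · exact fun h => ⟨LinearEquiv.ofBijective _ ⟨linearField_injective G, h⟩⟩

/-- The derivative of the quadratic map attached to a symmetric bilinear map. -/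
lemma hasFDerivAt_quadratic {U V : Type*} [NormedAddCommGroup U] [NormedSpace ℝ U]
    [NormedAddCommGroup V] [NormedSpace ℝ V] (B : U →L[ℝ] U →L[ℝ] V)
    (hB : ∀ u v, B u v = B v u) (y : U) :
    HasFDerivAt (fun y => B y y) ((2 : ℝ) • B y) y := by
  have h := B.hasFDerivAt_of_bilinear (hasFDerivAt_id y) (hasFDerivAt_id y)
  refine h.congr_fderiv ?_
  ext v
  simp [ContinuousLinearMap.precompR, ContinuousLinearMap.precompL, two_smul, hB v y]

lemma eq_zero_of_quadratic_eq_zero {U V : Type*} [NormedAddCommGroup U] [NormedSpace ℝ U]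
    [NormedAddCommGroup V] [NormedSpace ℝ V] (B : U →L[ℝ] U →L[ℝ] V)
    (hB : ∀ u v, B u v = B v u) (h : ∀ v, B v v = 0) : B = 0 := by
  ext u v
  have h1 := h (u + v)
  simp only [map_add, add_apply, h, hB v u, zero_add, add_zero] at h1
  rw [← two_smul ℝ] at h1
  simpa using h1

/-- The field y ↦ B(y, y) has derivative 2B(y, ·) ∈ 𝔤. If the field is linear, this derivative is
constant near 0; being zero at 0, it vanishes, and so does B. -/
lemma AllFieldsLinear.prolongationEqZero {G : Subgroup (GL (Fin p) ℝ)} (h : AllFieldsLinear G) :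
    ProlongationEqZero G := by
  intro B hB hG
  have hmem : ((fun y => B y y : (Fin p → ℝ) → (Fin p → ℝ)) : MapGerm p) ∈ theta0 G :=
    mem_theta0_iff.2 ⟨fun y => B y y, rfl, by simp, Eventually.of_forall fun y =>
      ⟨(B.isBoundedBilinearMap.contDiff.comp (contDiff_id.prodMk contDiff_id)).contDiffAt, by
        rw [(hasFDerivAt_quadratic B hB y).fderiv]
        exact Submodule.smul_mem _ _ (hG y)⟩⟩
  obtain ⟨L, hL⟩ := h.exists_clm hmem
  have hd : (fun y => (2 : ℝ) • B y) =ᶠ[𝓝 0] fun _ => L := by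
    filter_upwards [hL.fderiv (𝕜 := ℝ)] with y hy
    rw [← (hasFDerivAt_quadratic B hB y).fderiv, hy, L.fderiv]
  have h0 : L = 0 := by simpa using hd.self_of_nhds.symm
  have h2 := eventuallyEq_linear (L := (2 : ℝ) • B) (M := 0) (by
    rw [h0] at hd
    exact hd)
  simpa using h2

lemma two_le_infty : (2 : WithTop ℕ∞) ≤ ∞ := by
  exact WithTop.coe_le_coe.2 (le_top : (2 : ℕ∞) ≤ ⊤)

lemma contDiffAt_infty_fderiv {f : (Fin p → ℝ) → (Fin p → ℝ)} {y : Fin p → ℝ}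
    (hf : ContDiffAt ℝ ∞ f y) : ContDiffAt ℝ ∞ (fderiv ℝ f) y :=
  hf.fderiv_right (by simp)

/-- At each point near 0 the second derivative is symmetric and takes values in 𝔤, so it belongs to
the prolongation and is zero. -/
lemma ProlongationEqZero.allFieldsLinear {G : Subgroup (GL (Fin p) ℝ)}
    (h : ProlongationEqZero G) : AllFieldsLinear G := by
  intro η hη i
  obtain ⟨f, rfl, h0, hf⟩ := mem_theta0_iff.1 hη
  have key : f =ᶠ[𝓝 0] fun y => fderiv ℝ f 0 y := by
    refine eventuallyEq_fderiv_of_fderiv_fderiv_eq_zero h0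
      (hf.mono fun y hy => hy.1.differentiableAt (by simp))
      (hf.mono fun y hy => (contDiffAt_infty_fderiv hy.1).differentiableAt (by simp)) ?_
    filter_upwards [hf.eventually_nhds] with y hy
    have hy0 := hy.self_of_nhds.1
    refine h _ (fun u v => ?_) (fun v => ?_)
    · exact hy0.isSymmSndFDerivAt (by simpa using two_le_infty) u v
    · exact fderiv_mem_of_eventually_mem
        ((contDiffAt_infty_fderiv hy0).differentiableAt (by simp))
        (hy.mono fun z hz => hz.2) v
  exact ⟨LinearMap.proj i ∘ₗ (fderiv ℝ f 0).toLinearMap, Germ.coe_eq.2 (key.mono fun y hy => by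
    simp only [Function.comp_apply, LinearMap.coe_comp, LinearMap.proj_apply]
    exact congrFun hy i)⟩

/-- The definition of 𝔤 by curves smooth in the matrix space applies directly to the Jacobian along
a line, translated on the right so as to start at 1. No smooth structure on G enters. -/
lemma ProlongationEqZero.diffG_subset {G : Subgroup (GL (Fin p) ℝ)}
    (h : ProlongationEqZero G) : DiffG G ⊆ linGerm '' (G : Set (GL (Fin p) ℝ)) := by
  rintro _ ⟨f, rfl, ⟨h0, hf, -⟩, hG⟩
  have key : f =ᶠ[𝓝 0] fun y => fderiv ℝ f 0 y := by
    refine eventuallyEq_fderiv_of_fderiv_fderiv_eq_zero h0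
      (hf.mono fun y hy => hy.differentiableAt (by simp))
      (hf.mono fun y hy => (contDiffAt_infty_fderiv hy).differentiableAt (by simp)) ?_
    filter_upwards [hf.eventually_nhds, hG.eventually_nhds] with y hfy hGy
    have hy0 := hfy.self_of_nhds
    have hD := contDiffAt_infty_fderiv hy0
    obtain ⟨A, hA, hAy⟩ := mem_clmSet.1 hGy.self_of_nhds
    -- the logarithmic derivative of the Jacobi matrix lies in the Lie algebra
    have hlog : ∀ v, fderiv ℝ (fderiv ℝ f) y v * glCLM A⁻¹ ∈ lieAlgCLM G := by
      intro v
      have hl : ContDiff ℝ ∞ fun s : ℝ => y + s • v :=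
        contDiff_const.add (contDiff_id.smul contDiff_const)
      have ht : Tendsto (fun s : ℝ => y + s • v) (𝓝 0) (𝓝 y) := by
        simpa using hl.continuous.tendsto 0
      refine mem_lieAlgCLM_of_curve (c := fun s => fderiv ℝ f (y + s • v) * glCLM A⁻¹) ?_ ?_ ?_
      · simp [← hAy, glCLM_mul_inv]
      · filter_upwards [ht.eventually hfy, ht.eventually hGy] with s h1 h2
        refine ⟨mul_mem_clmSet h2 (mem_clmSet.2 ⟨_, G.inv_mem hA, rfl⟩), ?_⟩
        exact ((contDiffAt_infty_fderiv h1).comp s hl.contDiffAt).mul contDiffAt_const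
      · have hl' : HasDerivAt (fun s : ℝ => y + s • v) v 0 := by
          simpa using ((hasDerivAt_id (0 : ℝ)).smul_const v).const_add y
        have hD' : HasFDerivAt (fderiv ℝ f) (fderiv ℝ (fderiv ℝ f) y) (y + (0 : ℝ) • v) := by
          simpa using (hD.differentiableAt (by simp)).hasFDerivAt
        exact (hD'.comp_hasDerivAt (0 : ℝ) hl').mul_const _
    -- One factor A⁻¹ is the right translation in `hlog`; the other is inserted to keep B symmetric.
    -- As A is invertible, B = 0 gives f''(y) = 0.
    let B : (Fin p → ℝ) →L[ℝ] (Fin p → ℝ) →L[ℝ] (Fin p → ℝ) :=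
      (fderiv ℝ (fderiv ℝ f) y).bilinearComp (glCLM A⁻¹) (glCLM A⁻¹)
    have hB : B = 0 := by
      refine h B (fun u v => ?_) (fun v => ?_)
      · exact hy0.isSymmSndFDerivAt (by simpa using two_le_infty) _ _
      · exact hlog (glCLM A⁻¹ v)
    ext u v : 2
    have h1 : ∀ w, glCLM A⁻¹ (glCLM A w) = w := fun w =>
      congrArg (fun L : (Fin p → ℝ) →L[ℝ] (Fin p → ℝ) => L w) (glCLM_inv_mul A)
    have h2 : B (glCLM A u) (glCLM A v) = 0 := by rw [hB]; rfl
    simpa [B, h1] using h2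
  obtain ⟨A, hA, hAy⟩ := mem_clmSet.1 hG.self_of_nhds
  refine ⟨A, hA, ?_⟩
  rw [linGerm_eq, hAy]
  exact Germ.coe_eq.2 key.symm

/-! ### Charts of the immersed group at the identity. -/

/-- A smooth parametrization of a neighbourhood of the identity of a connected linear Lie group,
for the Lie group topology. -/
structure LocalParam (G : Subgroup (GL (Fin p) ℝ)) (d : ℕ) where
  /-- The parametrization. -/
  toFun : EuclideanSpace ℝ (Fin d) → (Fin p → ℝ) →L[ℝ] (Fin p → ℝ)
  /-- The parameter of the identity. -/
  base : EuclideanSpace ℝ (Fin d)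
  /-- The domain of the parametrization. -/
  dom : Set (EuclideanSpace ℝ (Fin d))
  isOpen_dom : IsOpen dom
  base_mem : base ∈ dom
  contDiffAt : ∀ u ∈ dom, ContDiffAt ℝ ∞ toFun u
  map_base : toFun base = 1
  toFun_mem_clmSet : ∀ u ∈ dom, toFun u ∈ clmSet G
  injective_fderiv : Function.Injective (fderiv ℝ toFun base)
  -- Together with the next field: the tangent space at `toFun u` is the right translate of the
  -- tangent space at 1.
  exists_fderiv_eq_mul : ∀ u ∈ dom, ∀ w, ∃ w',
    fderiv ℝ toFun base w * toFun u = fderiv ℝ toFun u w'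
  exists_mul_eq_fderiv : ∀ u ∈ dom, ∀ w, ∃ w',
    fderiv ℝ toFun u w = fderiv ℝ toFun base w' * toFun u
  -- Countably many right translates of any small plaque cover G; this feeds the Baire argument.
  exists_countable_cover : ∀ W ∈ 𝓝 base, ∃ Γ : Set (GL (Fin p) ℝ), Γ.Countable ∧
    ∀ A ∈ G, ∃ γ ∈ Γ, ∃ u ∈ W, glCLM A = toFun u * glCLM γ
  le_of_forall_mem : ∀ W ∈ 𝓝 base, ∀ S : Subgroup (GL (Fin p) ℝ),
    (∀ A : GL (Fin p) ℝ, (∃ u ∈ W, glCLM A = toFun u) → A ∈ S) → G ≤ S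

/-- A subgroup containing a neighbourhood of the identity in a connected group is everything. -/
lemma subgroup_eq_top_of_mem_nhds {H : Type*} [Group H] [TopologicalSpace H] [IsTopologicalGroup H]
    [ConnectedSpace H] (S : Subgroup H) (hS : (S : Set H) ∈ 𝓝 (1 : H)) : S = ⊤ := by
  have ho : IsOpen (S : Set H) := S.isOpen_of_mem_nhds hS
  have hc : IsClopen (S : Set H) := ⟨S.isClosed_of_isOpen ho, ho⟩
  exact SetLike.coe_injective (by simpa using hc.eq_univ ⟨1, S.one_mem⟩)

/-- A connected group in which some neighbourhood of the identity is separable has a countable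
dense subset. -/
lemma exists_countable_dense_of_connected {H : Type*} [Group H] [TopologicalSpace H]
    [IsTopologicalGroup H] [ConnectedSpace H] {N Q : Set H} (hN : N ∈ 𝓝 (1 : H))
    (hQ : Q.Countable) (hNQ : N ⊆ closure Q) : ∃ Γ : Set H, Γ.Countable ∧ Dense Γ := by
  have := hQ.to_subtype
  refine ⟨Subgroup.closure Q, ?_, ?_⟩
  · have h : Subgroup.closure Q = (FreeGroup.lift (Subtype.val : Q → H)).range := by
      rw [FreeGroup.range_lift_eq_closure, Subtype.range_coe]
    rw [h, MonoidHom.coe_range]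
    exact countable_range _
  · have h := subgroup_eq_top_of_mem_nhds (Subgroup.closure Q).topologicalClosure
      (mem_of_superset hN (hNQ.trans (closure_mono Subgroup.subset_closure)))
    rw [dense_iff_closure_eq, ← Subgroup.topologicalClosure_coe, h]
    rfl

/-- The immersion is read in the chart at 1. Smoothness of right translations moves tangent vectors
between points of the chart, and connectedness supplies both the generation property and the
countability, so H need not be assumed second countable. -/
theorem IsConnectedLinearLieGroup.exists_localParam {G : Subgroup (GL (Fin p) ℝ)}
    (hG : IsConnectedLinearLieGroup G) : ∃ d, Nonempty (LocalParam G d) := by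
  obtain ⟨d, H, _, _, _, _, _, φ, rfl, -, hφ, hinj⟩ := hG
  have : IsTopologicalGroup H := topologicalGroup_of_lieGroup (𝓡 d) ∞
  let F : H → (Fin p → ℝ) →L[ℝ] (Fin p → ℝ) := fun h => glCLM (φ h)
  have hF : ContMDiff (𝓡 d) 𝓘(ℝ, (Fin p → ℝ) →L[ℝ] (Fin p → ℝ)) ∞ F :=
    (entriesCLM p).contDiff.contMDiff.comp hφ
  have hFmul : ∀ g h, F (g * h) = F g * F h := fun g h => by simp [F, glCLM_mul]
  let e := extChartAt (𝓡 d) (1 : H)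
  have heo : IsOpen e.target := isOpen_extChartAt_target (I := 𝓡 d) (1 : H)
  have heso : IsOpen e.source := isOpen_extChartAt_source (I := 𝓡 d) (1 : H)
  have h1s : (1 : H) ∈ e.source := mem_extChartAt_source (I := 𝓡 d) (1 : H)
  have hb : e 1 ∈ e.target := e.map_source h1s
  have hb1 : e.symm (e 1) = 1 := e.left_inv h1s
  have hsymm : ∀ u ∈ e.target, ContMDiffAt 𝓘(ℝ, EuclideanSpace ℝ (Fin d)) (𝓡 d) ∞ e.symm u :=
    fun u hu => (contMDiffOn_extChartAt_symm (I := 𝓡 d) (n := ∞) (1 : H)).contMDiffAt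
      (heo.mem_nhds hu)
  have hsm : ∀ u ∈ e.target, ContDiffAt ℝ ∞ (fun u => F (e.symm u)) u := fun u hu =>
    (hF.contMDiffAt.comp u (hsymm u hu)).contDiffAt
  -- right translations, read in the chart
  have htr : ∀ u ∈ e.target, ∀ g : H, e.symm u * g ∈ e.source →
      ∀ w, ∃ w', fderiv ℝ (fun u => F (e.symm u)) u w * F g =
        fderiv ℝ (fun u => F (e.symm u)) (e (e.symm u * g)) w' := by
    intro u hu g hg w
    let θ : EuclideanSpace ℝ (Fin d) → EuclideanSpace ℝ (Fin d) := fun v => e (e.symm v * g)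
    have hθ : ContDiffAt ℝ ∞ θ u := by
      have h1 : ContMDiffAt (𝓡 d) 𝓘(ℝ, EuclideanSpace ℝ (Fin d)) ∞ e (e.symm u * g) :=
        contMDiffAt_extChartAt' (by simpa [e] using hg)
      have h2 : ContMDiffAt 𝓘(ℝ, EuclideanSpace ℝ (Fin d)) (𝓡 d) ∞ (fun v => e.symm v * g) u :=
        ((contMDiff_mul_right (I := 𝓡 d) (n := ∞) (a := g)).contMDiffAt (x := e.symm u)).comp u
          (hsymm u hu)
      exact (h1.comp u h2).contDiffAt
    have hcont : ContinuousAt (fun v => e.symm v * g) u :=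
      (hsymm u hu).continuousAt.mul continuousAt_const
    have hev : (fun v => F (e.symm (θ v))) =ᶠ[𝓝 u] fun v => F (e.symm v) * F g := by
      filter_upwards [hcont.preimage_mem_nhds (heso.mem_nhds hg)] with v hv
      simp only [θ, e.left_inv hv, hFmul]
    have ht : θ u ∈ e.target := e.map_source hg
    have hd1 : HasFDerivAt (fun v => F (e.symm (θ v))) _ u :=
      (((hsm _ ht).differentiableAt (by simp)).hasFDerivAt).comp u
        (hθ.differentiableAt (by simp)).hasFDerivAt
    have hd2 := (((hsm u hu).differentiableAt (by simp)).hasFDerivAt).mul_const' (F g)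
    refine ⟨fderiv ℝ θ u w, ?_⟩
    have := congrArg (fun L => L w) ((hd2.congr_of_eventuallyEq hev).unique hd1)
    simpa using this
  refine ⟨d, ⟨{
    toFun := fun u => F (e.symm u)
    base := e 1
    dom := e.target
    isOpen_dom := heo
    base_mem := hb
    contDiffAt := hsm
    map_base := by simp only [hb1, F, map_one, glCLM_one]
    toFun_mem_clmSet := fun u _ => mem_clmSet.2 ⟨_, ⟨_, rfl⟩, rfl⟩
    injective_fderiv := ?_
    exists_fderiv_eq_mul := ?_
    exists_mul_eq_fderiv := ?_
    exists_countable_cover := ?_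
    le_of_forall_mem := ?_ }⟩⟩
  · have h := hinj 1
    rw [(hφ.mdifferentiableAt (by simp)).mfderiv] at h
    simp only [mfld_simps, fderivWithin_univ] at h
    change Function.Injective (fderiv ℝ ((fun (h : H) i j =>
      (φ h : Matrix (Fin p) (Fin p) ℝ) i j) ∘ e.symm) (e 1)) at h
    have hc := (entriesCLM p).comp_fderiv (f := (fun (h : H) i j =>
      (φ h : Matrix (Fin p) (Fin p) ℝ) i j) ∘ e.symm) (x := e 1)
    change Function.Injective (fderiv ℝ (entriesCLM p ∘ ((fun (h : H) i j =>
      (φ h : Matrix (Fin p) (Fin p) ℝ) i j) ∘ e.symm)) (e 1))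
    rw [hc]
    exact (entriesCLM p).injective.comp h
  · intro u hu w
    have := htr _ hb (e.symm u) (by rw [hb1, one_mul]; exact e.map_target hu) w
    simpa only [hb1, one_mul, e.right_inv hu] using this
  -- Translation by the inverse brings the tangent vector at u back to the base point.
  · intro u hu w
    obtain ⟨w', hw'⟩ := htr _ hu (e.symm u)⁻¹ (by rw [mul_inv_cancel]; exact h1s) w
    rw [mul_inv_cancel] at hw'
    refine ⟨w', ?_⟩
    rw [← hw', mul_assoc, ← hFmul, inv_mul_cancel]
    simp [F, glCLM_one]
  · intro W hW
    obtain ⟨Q, hQc, hQd⟩ := TopologicalSpace.exists_countable_dense e.target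
    have hcs : Continuous fun u : e.target => e.symm u :=
      continuousOn_iff_continuous_domRestrict.1 fun u hu =>
        (hsymm u hu).continuousAt.continuousWithinAt
    have hN : e.source ⊆ closure ((fun u : e.target => e.symm u) '' Q) := by
      intro h hh
      refine hcs.range_subset_closure_image_dense hQd ⟨⟨e h, e.map_source hh⟩, ?_⟩
      exact e.left_inv hh
    obtain ⟨Γ, hΓ, hd⟩ := exists_countable_dense_of_connected
      (N := e.source) (heso.mem_nhds h1s) (hQc.image _) hN
    refine ⟨φ '' Γ, hΓ.image _, ?_⟩
    rintro _ ⟨h, rfl⟩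
    have hW' : e.source ∩ e ⁻¹' W ∈ 𝓝 (1 : H) :=
      inter_mem (heso.mem_nhds h1s)
        ((continuousAt_extChartAt (I := 𝓡 d) (1 : H)).preimage_mem_nhds hW)
    -- Density of Γ gives γ with hγ⁻¹ in the prescribed neighbourhood of 1, and h = (hγ⁻¹)γ.
    have hcont : ContinuousAt (fun γ => h * γ⁻¹) h := by fun_prop
    have : (fun γ => h * γ⁻¹) ⁻¹' (e.source ∩ e ⁻¹' W) ∈ 𝓝 h :=
      hcont.preimage_mem_nhds (by rwa [mul_inv_cancel])
    obtain ⟨γ, hγΓ, hγ⟩ := hd.inter_nhds_nonempty this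
    refine ⟨φ γ, ⟨γ, hγΓ, rfl⟩, e (h * γ⁻¹), hγ.2, ?_⟩
    rw [e.left_inv hγ.1]
    change F h = F _ * F γ
    rw [← hFmul, inv_mul_cancel_right]
  · intro W hW S hS
    have hW' : e.source ∩ e ⁻¹' W ∈ 𝓝 (1 : H) :=
      inter_mem (heso.mem_nhds h1s)
        ((continuousAt_extChartAt (I := 𝓡 d) (1 : H)).preimage_mem_nhds hW)
    have htop := subgroup_eq_top_of_mem_nhds (S.comap φ) (mem_of_superset hW' fun h hh =>
      hS _ ⟨e h, hh.2, by rw [e.left_inv hh.1]⟩)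
    rintro _ ⟨h, rfl⟩
    have : h ∈ S.comap φ := htop ▸ Subgroup.mem_top h
    exact this

lemma glCLM_injective : Function.Injective (glCLM : GL (Fin p) ℝ → _) := fun _ _ h =>
  Units.ext ((clmMatrix p).symm.injective h)

lemma glCLM_mem_clmSet {G : Subgroup (GL (Fin p) ℝ)} {A : GL (Fin p) ℝ} :
    glCLM A ∈ clmSet G ↔ A ∈ G := by
  rw [mem_clmSet]
  constructor
  · rintro ⟨B, hB, h⟩
    rwa [← glCLM_injective h]
  · exact fun h => ⟨A, h, rfl⟩

/-! ### Invariance of a retract under linear differential equations. -/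

lemma eventually_differentiableAt_of_contDiffAt {U V : Type*} [NormedAddCommGroup U]
    [NormedSpace ℝ U] [NormedAddCommGroup V] [NormedSpace ℝ V] {F : U → V} {x : U}
    (h : ContDiffAt ℝ 1 F x) : ∀ᶠ y in 𝓝 x, DifferentiableAt ℝ F y :=
  (h.eventually (by simp)).mono fun _ hy => hy.differentiableAt (by simp)

/-- If right invariant fields are tangent to the image of a retraction `P` near `1`, then solutions
of the corresponding linear equations stay in this image. -/
lemma exists_forall_ode_fixed {R : Type*} [NormedRing R] [NormedAlgebra ℝ R] {P : R → R}
    {S : Submodule ℝ R} (hP : ContDiffAt ℝ 2 P 1) (hP1 : P 1 = 1)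
    (hPS : ∀ᶠ m in 𝓝 (1 : R), ∀ a ∈ S, fderiv ℝ P (P m) (a * P m) = a * P m) :
    ∃ ε > 0, ∀ M a : ℝ → R,
    (∀ t ∈ Icc (0 : ℝ) 1, a t ∈ S ∧ ‖a t‖ ≤ 1 ∧ ‖M t - 1‖ < ε ∧
      HasDerivAt M (a t * M t) t) → M 0 = 1 → P (M 1) = M 1 := by
  let mulR : R →L[ℝ] R →L[ℝ] R := (ContinuousLinearMap.mul ℝ R).flip
  -- W m a measures how far a·m is from being fixed by the derivative of P at m. It is the velocity
  -- of M - P(M) and vanishes at P(m) for a ∈ S; as W is locally Lipschitz, M - P(M) satisfies a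
  -- Gronwall inequality with zero initial value.
  let W : R → R →L[ℝ] R := fun m => mulR m - (fderiv ℝ P m).comp (mulR m)
  have hWa : ∀ m a, W m a = a * m - fderiv ℝ P m (a * m) := fun m a => rfl
  have hW : ContDiffAt ℝ 1 W 1 := by
    have h1 : ContDiffAt ℝ 1 (fderiv ℝ P) 1 :=
      hP.fderiv_right (by norm_num [one_add_one_eq_two])
    have h2 : ContDiffAt ℝ 1 (fun m => mulR m) 1 := mulR.contDiff.contDiffAt
    exact h2.sub (h1.clm_comp h2)
  obtain ⟨K, s, hs, hLip⟩ := hW.exists_lipschitzOnWith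
  have hPs : ∀ᶠ m in 𝓝 (1 : R), P m ∈ s := by
    have h2 := hP.continuousAt
    rw [ContinuousAt, hP1] at h2
    exact h2.eventually hs
  have hPd : ∀ᶠ m in 𝓝 (1 : R), DifferentiableAt ℝ P m :=
    eventually_differentiableAt_of_contDiffAt (hP.of_le (by norm_num))
  obtain ⟨ε, hε, hball⟩ := Metric.eventually_nhds_iff_ball.1 (hPS.and (hPs.and (hPd.and hs)))
  refine ⟨ε, hε, fun M a hM hM0 => ?_⟩
  have hmem : ∀ t ∈ Icc (0 : ℝ) 1, M t ∈ Metric.ball 1 ε := fun t ht => by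
    rw [mem_ball_iff_norm]
    exact (hM t ht).2.2.1
  have hD : ∀ t ∈ Icc (0 : ℝ) 1, HasDerivAt (fun t => M t - P (M t)) (W (M t) (a t)) t := by
    intro t ht
    have h1 := (hM t ht).2.2.2
    exact h1.sub (((hball _ (hmem t ht)).2.2.1).hasFDerivAt.comp_hasDerivAt t h1)
  have hbound : ∀ t ∈ Ico (0 : ℝ) 1, ‖W (M t) (a t)‖ ≤ K * ‖M t - P (M t)‖ := by
    intro t ht
    have ht := Ico_subset_Icc_self ht
    have hb := hball _ (hmem t ht)
    obtain ⟨ha, ha1, -, -⟩ := hM t ht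
    have h0 : W (P (M t)) (a t) = 0 := by rw [hWa, hb.1 _ ha, sub_self]
    have h1 : W (M t) (a t) = (W (M t) - W (P (M t))) (a t) := by
      change W (M t) (a t) = W (M t) (a t) - W (P (M t)) (a t)
      rw [h0, sub_zero]
    rw [h1]
    calc _ ≤ ‖W (M t) - W (P (M t))‖ * ‖a t‖ := ContinuousLinearMap.le_opNorm _ _
      _ ≤ ‖W (M t) - W (P (M t))‖ * 1 := by gcongr
      _ ≤ K * ‖M t - P (M t)‖ := by
        rw [mul_one]
        exact hLip.norm_sub_le hb.2.2.2 hb.2.1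
  have hzero := eq_zero_of_abs_deriv_le_mul_abs_self_of_eq_zero_right (K := K)
    (fun t ht => (hD t ht).continuousAt.continuousWithinAt)
    (fun t ht => (hD t (Ico_subset_Icc_self ht)).hasDerivWithinAt)
    (by simp [hM0, hP1]) hbound
  exact (sub_eq_zero.1 (hzero 1 ⟨zero_le_one, le_rfl⟩)).symm

/-! ### Paths, tangent space and linear equations in G. -/

namespace LocalParam

variable {G : Subgroup (GL (Fin p) ℝ)} {d : ℕ}

/-- The elements of `G` are joined to the identity by smooth curves in `G`. -/
lemma exists_path (Λ : LocalParam G d) {A : GL (Fin p) ℝ} (hA : A ∈ G) :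
    ∃ c : ℝ → (Fin p → ℝ) →L[ℝ] (Fin p → ℝ), ContDiff ℝ ∞ c ∧ (∀ t, c t ∈ clmSet G) ∧
      c 0 = 1 ∧ c 1 = glCLM A := by
  obtain ⟨r, hr, hb⟩ := Metric.isOpen_iff.1 Λ.isOpen_dom _ Λ.base_mem
  let S : Subgroup (GL (Fin p) ℝ) :=
    { carrier := {A | A ∈ G ∧ ∃ c : ℝ → (Fin p → ℝ) →L[ℝ] (Fin p → ℝ), ContDiff ℝ ∞ c ∧
        (∀ t, c t ∈ clmSet G) ∧ c 0 = 1 ∧ c 1 = glCLM A}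
      one_mem' := ⟨G.one_mem, fun _ => 1, contDiff_const,
        fun _ => glCLM_one (p := p) ▸ glCLM_mem_clmSet.2 G.one_mem, rfl, glCLM_one.symm⟩
      mul_mem' := by
        rintro A B ⟨hA, c, hc, hcG, hc0, hc1⟩ ⟨hB, e, he, heG, he0, he1⟩
        exact ⟨G.mul_mem hA hB, fun t => c t * e t, hc.mul he,
          fun t => mul_mem_clmSet (hcG t) (heG t), by simp [hc0, he0],
          by simp [hc1, he1, glCLM_mul]⟩
      inv_mem' := by
        rintro A ⟨hA, c, hc, hcG, hc0, hc1⟩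
        -- The reversed path, translated by A⁻¹ so as to start at 1; inversion need not be
        -- differentiated.
        refine ⟨G.inv_mem hA, fun t => c (1 - t) * glCLM A⁻¹,
          (hc.comp (contDiff_const.sub contDiff_id)).mul contDiff_const,
          fun t => mul_mem_clmSet (hcG _) (glCLM_mem_clmSet.2 (G.inv_mem hA)), ?_, ?_⟩
        · simp [hc1, glCLM_mul_inv]
        · simp [hc0] }
  have hS : G ≤ S := by
    refine Λ.le_of_forall_mem _ (Metric.ball_mem_nhds _ hr) S ?_
    rintro A ⟨u, hu, hAu⟩
    -- The smooth transition takes values in [0, 1], so the parameter stays on the segment from the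
    -- base to u for every real t.
    have hmem : ∀ t : ℝ, Λ.base + Real.smoothTransition t • (u - Λ.base) ∈ Λ.dom := by
      intro t
      refine hb ((convex_ball Λ.base r).add_smul_sub_mem (Metric.mem_ball_self hr) hu ?_)
      exact ⟨Real.smoothTransition.nonneg t, Real.smoothTransition.le_one t⟩
    refine ⟨glCLM_mem_clmSet.1 (hAu ▸ Λ.toFun_mem_clmSet _ (hb hu)),
      fun t => Λ.toFun (Λ.base + Real.smoothTransition t • (u - Λ.base)), ?_,
      fun t => Λ.toFun_mem_clmSet _ (hmem t), ?_, ?_⟩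
    · rw [contDiff_iff_contDiffAt]
      intro t
      have hl : ContDiff ℝ ∞ fun t : ℝ => Λ.base + Real.smoothTransition t • (u - Λ.base) :=
        contDiff_const.add (Real.smoothTransition.contDiff.smul contDiff_const)
      exact (Λ.contDiffAt _ (hmem t)).comp t hl.contDiffAt
    · simp [Real.smoothTransition.zero, Λ.map_base]
    · simp [Real.smoothTransition.one, hAu]
  exact (hS hA).2

/-- A smooth left inverse of the parametrization. -/
lemma exists_leftInverse (Λ : LocalParam G d) : ∃ ρ : ((Fin p → ℝ) →L[ℝ] (Fin p → ℝ)) → EuclideanSpace ℝ (Fin d),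
    ContDiffAt ℝ ∞ ρ 1 ∧ ∀ᶠ u in 𝓝 Λ.base, ρ (Λ.toFun u) = u := by
  obtain ⟨l, hl⟩ := LinearMap.exists_leftInverse_of_injective
    -- After composition with a linear left inverse of its differential, the parametrization has
    -- identity differential, and the inverse function theorem applies.
    (fderiv ℝ Λ.toFun Λ.base).toLinearMap (LinearMap.ker_eq_bot.2 Λ.injective_fderiv)
  let L := LinearMap.toContinuousLinearMap l
  have hb := Λ.contDiffAt _ Λ.base_mem
  have hk : ContDiffAt ℝ ∞ (fun u => L (Λ.toFun u)) Λ.base :=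
    L.contDiff.contDiffAt.comp _ hb
  have hk' : HasFDerivAt (fun u => L (Λ.toFun u))
      (ContinuousLinearEquiv.refl ℝ (EuclideanSpace ℝ (Fin d)) :
        EuclideanSpace ℝ (Fin d) →L[ℝ] EuclideanSpace ℝ (Fin d)) Λ.base := by
    refine (L.hasFDerivAt.comp _ (hb.differentiableAt (by simp)).hasFDerivAt).congr_fderiv ?_
    ext1 v
    exact congrArg (fun m => m v) hl
  refine ⟨fun m => hk.localInverse hk' (by simp) (L m), ?_, ?_⟩
  · have h := hk.to_localInverse hk' (by simp)
    simp only [Λ.map_base] at h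
    exact h.comp 1 L.contDiff.contDiffAt
  · exact (hk.hasStrictFDerivAt' hk' (by simp)).eventually_left_inverse

lemma eventually_differentiableAt (Λ : LocalParam G d)
    {ρ : ((Fin p → ℝ) →L[ℝ] (Fin p → ℝ)) → EuclideanSpace ℝ (Fin d)} (hρ : ContDiffAt ℝ ∞ ρ 1) :
    ∀ᶠ u in 𝓝 Λ.base, DifferentiableAt ℝ ρ (Λ.toFun u) := by
  have h2 := (Λ.contDiffAt _ Λ.base_mem).continuousAt
  rw [ContinuousAt, Λ.map_base] at h2
  exact h2.eventually (eventually_differentiableAt_of_contDiffAt (hρ.of_le (by simp)))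

/-- The Lie algebra is contained in the tangent space at the identity. -/
lemma exists_fderiv_eq_of_mem_lieAlgCLM (Λ : LocalParam G d) {X : (Fin p → ℝ) →L[ℝ] (Fin p → ℝ)}
    (hX : X ∈ lieAlgCLM G) : ∃ w, fderiv ℝ Λ.toFun Λ.base w = X := by
  obtain ⟨c, hc0, hc, hcX⟩ := exists_curve_of_mem_lieAlgCLM hX
  obtain ⟨ρ, hρ, hρΛ⟩ := Λ.exists_leftInverse
  obtain ⟨π, hπ⟩ := exists_clm_ker_eq (LinearMap.range (fderiv ℝ Λ.toFun Λ.base).toLinearMap)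
  change X ∈ LinearMap.range (fderiv ℝ Λ.toFun Λ.base).toLinearMap
  rw [← hπ]
  have hρev := Λ.eventually_differentiableAt hρ
  obtain ⟨r, hr, hball⟩ := Metric.nhds_basis_closedBall.eventually_iff.1
    (hρev.and (hρΛ.and (Λ.isOpen_dom.mem_nhds Λ.base_mem)))
  -- The curve need not be continuous for the Lie group topology. But the compact plaque `Λ.toFun ''
  -- closedBall` is closed in the matrix space, and countably many of its translates cover G; by
  -- Baire, at a dense set of times near 0 the curve stays locally in one translate.
  obtain ⟨Γ, hΓ, hcover⟩ := Λ.exists_countable_cover _ (Metric.closedBall_mem_nhds Λ.base hr)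
  have hK : IsCompact (Λ.toFun '' Metric.closedBall Λ.base r) :=
    (isCompact_closedBall Λ.base r).image_of_continuousOn fun u hu =>
      (Λ.contDiffAt u (hball hu).2.2).continuousAt.continuousWithinAt
  -- the derivative of `c` is tangent to the group at times accumulating at `0`
  have key : ∃ᶠ t in 𝓝 (0 : ℝ), ∃ Y, π Y = 0 ∧ deriv c t = Y * c t := by
    rw [Metric.nhds_basis_ball.frequently_iff]
    intro ε' hε'
    obtain ⟨δ, hδ, hcδ⟩ := Metric.nhds_basis_closedBall.eventually_iff.1 hc
    let ε := min ε' δ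
    have hε : 0 < ε := lt_min hε' hδ
    have hsub : Metric.closedBall (0 : ℝ) ε ⊆ Metric.closedBall 0 δ :=
      Metric.closedBall_subset_closedBall (min_le_right _ _)
    have hccont : ContinuousOn c (Metric.closedBall 0 ε) := fun t ht =>
      (hcδ (hsub ht)).2.continuousAt.continuousWithinAt
    have : Countable Γ := hΓ.to_subtype
    -- The extra index `none` holds the complement of the interval, so that closed sets cover the
    -- whole line.
    let T : Option Γ → Set ℝ := fun o => o.elim (Metric.ball (0 : ℝ) ε)ᶜ fun γ =>
      Metric.closedBall 0 ε ∩ (fun t => c t * glCLM γ.1⁻¹) ⁻¹'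
        (Λ.toFun '' Metric.closedBall Λ.base r)
    have hTc : ∀ o, IsClosed (T o) := by
      rintro (_ | γ)
      · exact Metric.isOpen_ball.isClosed_compl
      · exact (hccont.mul continuousOn_const).preimage_isClosed_of_isClosed
          Metric.isClosed_closedBall hK.isClosed
    have hTu : ⋃ o, T o = univ := by
      refine eq_univ_of_forall fun t => mem_iUnion.2 ?_
      by_cases ht : t ∈ Metric.ball (0 : ℝ) ε
      · have htc := Metric.ball_subset_closedBall ht
        obtain ⟨A, hA, hAc⟩ := mem_clmSet.1 (hcδ (hsub htc)).1
        obtain ⟨γ, hγ, u, hu, hAu⟩ := hcover A hA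
        refine ⟨some ⟨γ, hγ⟩, htc, u, hu, ?_⟩
        simp only [← hAc, hAu, mul_assoc, glCLM_mul_inv, mul_one]
      · exact ⟨none, ht⟩
    obtain ⟨t, ht, hti⟩ := (dense_iUnion_interior_of_closed hTc hTu).inter_open_nonempty _
      Metric.isOpen_ball ⟨0, Metric.mem_ball_self hε⟩
    obtain ⟨o, ho⟩ := mem_iUnion.1 hti
    refine ⟨t, Metric.ball_subset_ball (min_le_left _ _) ht, ?_⟩
    rcases o with _ | γ
    · exact absurd ht (interior_subset ho)
    let e : ℝ → (Fin p → ℝ) →L[ℝ] (Fin p → ℝ) := fun t => c t * glCLM γ.1⁻¹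
    have hcd : HasDerivAt c (deriv c t) t :=
      ((hcδ (hsub (Metric.ball_subset_closedBall ht))).2.differentiableAt (by simp)).hasDerivAt
    have hed : HasDerivAt e (deriv c t * glCLM γ.1⁻¹) t := hcd.mul_const _
    obtain ⟨u, hu, hut'⟩ := (interior_subset ho).2
    have hut : Λ.toFun u = e t := hut'
    have hρe : ρ (e t) = u := by
      rw [← hut]
      exact (hball hu).2.1
    -- Inside a plaque the curve factors smoothly through the parameters, so its velocity is tangent
    -- to the plaque.
    have hev : (fun s => Λ.toFun (ρ (e s))) =ᶠ[𝓝 t] e := by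
      filter_upwards [mem_interior_iff_mem_nhds.1 ho] with s hs
      obtain ⟨v, hv, hvs'⟩ := hs.2
      have hvs : Λ.toFun v = e s := hvs'
      rw [← hvs, (hball hv).2.1]
    have hρd : HasFDerivAt ρ (fderiv ℝ ρ (e t)) (e t) := by
      refine DifferentiableAt.hasFDerivAt ?_
      rw [← hut]
      exact (hball hu).1
    have hΛd : HasFDerivAt Λ.toFun (fderiv ℝ Λ.toFun u) (ρ (e t)) := by
      rw [hρe]
      exact ((Λ.contDiffAt u (hball hu).2.2).differentiableAt (by simp)).hasFDerivAt
    have hd := (hΛd.comp_hasDerivAt t (hρd.comp_hasDerivAt t hed)).congr_of_eventuallyEq hev.symm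
    obtain ⟨w, hw⟩ := Λ.exists_mul_eq_fderiv u (hball hu).2.2
      (fderiv ℝ ρ (e t) (deriv c t * glCLM γ.1⁻¹))
    have heq := hed.unique hd
    rw [hw] at heq
    refine ⟨_, (hπ _).2 ⟨w, rfl⟩, ?_⟩
    have h3 := congrArg (· * glCLM γ.1) heq
    simp only [mul_assoc, glCLM_inv_mul, mul_one] at h3
    rw [h3]
    congr 1
    change Λ.toFun u * glCLM γ.1 = c t
    rw [hut]
    simp only [e, mul_assoc, glCLM_inv_mul, mul_one]
  -- pass to the limit
  have hc0s := hc.self_of_nhds.2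
  have hdc : ContinuousAt (deriv c) 0 :=
    (hc0s.derivWithin (m := 0) (by simp)).continuousAt
  have hinv : ContinuousAt (fun t => π (deriv c t * Ring.inverse (c t))) 0 := by
    refine π.continuous.continuousAt.comp (hdc.mul ?_)
    refine ContinuousAt.comp (g := Ring.inverse) ?_ hc0s.continuousAt
    rw [hc0]
    exact NormedRing.inverse_continuousAt 1
  have hunit : ∀ᶠ t in 𝓝 (0 : ℝ), IsUnit (c t) := by
    filter_upwards [hc] with t ht
    obtain ⟨A, -, hA⟩ := mem_clmSet.1 ht.1
    rw [← hA]
    exact ⟨⟨_, _, glCLM_mul_inv A, glCLM_inv_mul A⟩, rfl⟩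
  have hfreq : ∃ᶠ t in 𝓝 (0 : ℝ), π (deriv c t * Ring.inverse (c t)) = 0 := by
    refine (key.and_eventually hunit).mono ?_
    rintro t ⟨⟨Y, hY, hcY⟩, hu⟩
    rw [hcY, mul_assoc, Ring.mul_inverse_cancel _ hu, mul_one, hY]
  have hlim := isClosed_singleton.mem_of_frequently_of_tendsto hfreq hinv
  simpa [hc0, hcX.deriv] using hlim

/-- A solution near the identity of a linear equation with coefficients in the Lie algebra stays in
the group. -/
lemma exists_forall_ode_mem (Λ : LocalParam G d) :
    ∃ ε > 0, ∀ M a : ℝ → (Fin p → ℝ) →L[ℝ] (Fin p → ℝ),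
    (∀ t ∈ Icc (0 : ℝ) 1, a t ∈ lieAlgCLM G ∧ ‖a t‖ ≤ 1 ∧ ‖M t - 1‖ < ε ∧
      HasDerivAt M (a t * M t) t) → M 0 = 1 → M 1 ∈ clmSet G := by
  obtain ⟨ρ, hρ, hρΛ⟩ := Λ.exists_leftInverse
  have hρ1 : ρ 1 = Λ.base := by
    have := hρΛ.self_of_nhds
    rwa [Λ.map_base] at this
  let P : ((Fin p → ℝ) →L[ℝ] (Fin p → ℝ)) → (Fin p → ℝ) →L[ℝ] (Fin p → ℝ) := fun m =>
    Λ.toFun (ρ m)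
  have hP1 : P 1 = 1 := by simp only [P, hρ1, Λ.map_base]
  have hP : ContDiffAt ℝ ∞ P 1 := by
    refine ContDiffAt.comp (g := Λ.toFun) 1 ?_ hρ
    rw [hρ1]
    exact Λ.contDiffAt _ Λ.base_mem
  have hρtends : Tendsto ρ (𝓝 1) (𝓝 Λ.base) := by
    have h2 := hρ.continuousAt
    rwa [ContinuousAt, hρ1] at h2
  have hWP : ∀ᶠ m in 𝓝 (1 : (Fin p → ℝ) →L[ℝ] (Fin p → ℝ)),
      ∀ a ∈ lieAlgCLM G, fderiv ℝ P (P m) (a * P m) = a * P m := by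
    have h1 : ∀ᶠ u in 𝓝 Λ.base, ∀ a ∈ lieAlgCLM G,
        fderiv ℝ P (Λ.toFun u) (a * Λ.toFun u) = a * Λ.toFun u := by
      have hρ' : ∀ᶠ u in 𝓝 Λ.base, DifferentiableAt ℝ ρ (Λ.toFun u) :=
        Λ.eventually_differentiableAt hρ
      filter_upwards [hρΛ.eventually_nhds, hρ', Λ.isOpen_dom.mem_nhds Λ.base_mem]
        with u hu hud hdom a ha
      -- The vector aΛ(u) is tangent to the image at Λ(u), and the derivative of the retraction Λ ∘
      -- ρ is the identity on such vectors.
      obtain ⟨w₀, rfl⟩ := Λ.exists_fderiv_eq_of_mem_lieAlgCLM ha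
      obtain ⟨w, hw⟩ := Λ.exists_fderiv_eq_mul u hdom w₀
      have hΛd := ((Λ.contDiffAt u hdom).differentiableAt (by simp)).hasFDerivAt
      have hid : (fderiv ℝ ρ (Λ.toFun u)).comp (fderiv ℝ Λ.toFun u) = .id ℝ _ :=
        (hud.hasFDerivAt.comp u hΛd).unique ((hasFDerivAt_id u).congr_of_eventuallyEq hu)
      have hPd : HasFDerivAt P ((fderiv ℝ Λ.toFun u).comp (fderiv ℝ ρ (Λ.toFun u)))
          (Λ.toFun u) := by
        refine HasFDerivAt.comp (g := Λ.toFun) _ ?_ hud.hasFDerivAt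
        rwa [hu.self_of_nhds]
      have hidw : fderiv ℝ ρ (Λ.toFun u) (fderiv ℝ Λ.toFun u w) = w :=
        congrArg (fun L => L w) hid
      rw [hPd.fderiv, hw, ContinuousLinearMap.comp_apply, hidw]
    exact hρtends.eventually h1
  have hPG : ∀ᶠ m in 𝓝 (1 : (Fin p → ℝ) →L[ℝ] (Fin p → ℝ)), P m ∈ clmSet G :=
    (hρtends.eventually (Λ.isOpen_dom.mem_nhds Λ.base_mem)).mono
      fun m hm => Λ.toFun_mem_clmSet _ hm
  obtain ⟨ε, hε, hode⟩ := exists_forall_ode_fixed (hP.of_le two_le_infty) hP1 hWP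
  obtain ⟨ε', hε', hball⟩ := Metric.eventually_nhds_iff_ball.1 hPG
  refine ⟨min ε ε', lt_min hε hε', fun M a hM hM0 => ?_⟩
  rw [← hode M a (fun t ht => ⟨(hM t ht).1, (hM t ht).2.1,
    (hM t ht).2.2.1.trans_le (min_le_left _ _), (hM t ht).2.2.2⟩) hM0]
  refine hball _ ?_
  rw [mem_ball_iff_norm]
  exact (hM 1 ⟨zero_le_one, le_rfl⟩).2.2.1.trans_le (min_le_right _ _)

end LocalParam

end GDiff
end

noncomputable section

namespace GDiff

/-! ### Quadratic fixed point equations in Banach spaces. -/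

section FixedPoint

variable {X Y : Type*} [NormedAddCommGroup X] [NormedSpace ℝ X] [NormedAddCommGroup Y]
  [NormedSpace ℝ Y]

/-- The quadratic fixed point equation `x = c y + t T(x, x)` has, near the origin, a solution
depending analytically on `(y, t)`. -/
lemma exists_quadratic_fixedPoint [CompleteSpace X] (c : Y →L[ℝ] X) (T : X →L[ℝ] X →L[ℝ] X) :
    ∃ x : Y × ℝ → X, ContDiffAt ℝ ω x 0 ∧
      ∀ᶠ q in 𝓝 (0 : Y × ℝ), x q = c q.1 + q.2 • T (x q) (x q) ∧ x (0, q.2) = 0 := by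
  -- F has identity differential at 0, and x is the first component of its local inverse at (c y,
  -- t). The identity F(0, t) = (0, t) yields x(0, t) = 0.
  let F : X × ℝ → X × ℝ := fun z => (z.1 - z.2 • T z.1 z.1, z.2)
  have hT : ContDiff ℝ ω fun z : X × ℝ => T z.1 z.1 :=
    T.isBoundedBilinearMap.contDiff.comp (contDiff_fst.prodMk contDiff_fst)
  have hF : ContDiffAt ℝ ω F 0 :=
    ((contDiff_fst.sub (contDiff_snd.smul hT)).prodMk contDiff_snd).contDiffAt
  have hF' : HasFDerivAt F (ContinuousLinearEquiv.refl ℝ (X × ℝ) : X × ℝ →L[ℝ] X × ℝ) 0 := by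
    have h1 : HasFDerivAt (fun z : X × ℝ => T z.1 z.1) (fderiv ℝ (fun z : X × ℝ => T z.1 z.1) 0) 0 :=
      (hT.differentiable (by simp) 0).hasFDerivAt
    have h2 : HasFDerivAt (fun z : X × ℝ => z.2 • T z.1 z.1) (0 : X × ℝ →L[ℝ] X) 0 := by
      refine (hasFDerivAt_snd.smul h1).congr_fderiv ?_
      ext v <;> simp
    refine ((hasFDerivAt_fst.sub h2).prodMk hasFDerivAt_snd).congr_fderiv ?_
    ext v <;> simp
  have hF0 : F 0 = 0 := by simp [F]
  let Θ := hF.localInverse hF' (by simp)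
  have hΘ : ContDiffAt ℝ ω Θ 0 := by
    have := hF.to_localInverse hF' (by simp)
    rwa [hF0] at this
  have hr : ∀ᶠ z in 𝓝 (0 : X × ℝ), F (Θ z) = z := by
    have := (hF.hasStrictFDerivAt' hF' (by simp)).eventually_right_inverse
    rwa [hF0] at this
  have hl : ∀ᶠ z in 𝓝 (0 : X × ℝ), Θ (F z) = z :=
    (hF.hasStrictFDerivAt' hF' (by simp)).eventually_left_inverse
  have hc : ContDiff ℝ ω fun q : Y × ℝ => (c q.1, q.2) :=
    (c.contDiff.comp contDiff_fst).prodMk contDiff_snd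
  have hct : Tendsto (fun q : Y × ℝ => (c q.1, q.2)) (𝓝 0) (𝓝 0) := by
    exact hc.continuous.tendsto' _ _ (by simp)
  have hzt : Tendsto (fun q : Y × ℝ => ((0 : X), q.2)) (𝓝 0) (𝓝 0) := by
    have h : Continuous fun q : Y × ℝ => ((0 : X), q.2) := by fun_prop
    exact h.tendsto' _ _ rfl
  refine ⟨fun q => (Θ (c q.1, q.2)).1, ?_, ?_⟩
  · refine contDiffAt_fst.comp 0 (ContDiffAt.comp (g := Θ) 0 ?_ hc.contDiffAt)
    simpa [← Prod.zero_eq_mk] using hΘ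
  · filter_upwards [hct.eventually hr, hzt.eventually hl] with q h1 h2
    have h3 : (Θ (c q.1, q.2)).2 = q.2 := congrArg Prod.snd h1
    have h4 := congrArg Prod.fst h1
    simp only [F, h3] at h4
    refine ⟨sub_eq_iff_eq_add.1 h4, ?_⟩
    simp only [F, map_zero, smul_zero, sub_zero] at h2 ⊢
    rw [h2]

/-- The partial derivative with respect to `y` of the solution of the fixed point equation. -/
lemma eventually_quadratic_fixedPoint_deriv {c : Y →L[ℝ] X} {T : X →L[ℝ] X →L[ℝ] X}
    (hT : ∀ u v, T u v = T v u) {x : Y × ℝ → X} (hx : ContDiffAt ℝ ω x 0)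
    (heq : ∀ᶠ q in 𝓝 (0 : Y × ℝ), x q = c q.1 + q.2 • T (x q) (x q)) :
    ∀ᶠ q in 𝓝 (0 : Y × ℝ), ∃ D : Y →L[ℝ] X, D = (fderiv ℝ x q).comp (.inl ℝ Y ℝ) ∧
      HasFDerivAt (fun y => x (y, q.2)) D q.1 ∧ D = c + (2 * q.2) • (T (x q)).comp D := by
  filter_upwards [heq.eventually_nhds, hx.eventually (by simp)] with q hq hxq
  have hd := (hxq.differentiableAt (by simp)).hasFDerivAt
  have hD : HasFDerivAt (fun y => x (y, q.2)) ((fderiv ℝ x q).comp (.inl ℝ Y ℝ)) q.1 :=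
    HasFDerivAt.comp (g := x) q.1 (by exact hd) (hasFDerivAt_prodMk_left q.1 q.2)
  refine ⟨_, rfl, hD, ?_⟩
  have ht : Tendsto (fun y : Y => (y, q.2)) (𝓝 q.1) (𝓝 q) :=
    (Continuous.prodMk_left q.2).tendsto' _ _ rfl
  have hr : HasFDerivAt (fun y => c y + q.2 • T (x (y, q.2)) (x (y, q.2)))
      (c + q.2 • ((2 : ℝ) • T (x q)).comp ((fderiv ℝ x q).comp (.inl ℝ Y ℝ))) q.1 :=
    c.hasFDerivAt.add ((HasFDerivAt.comp (g := fun z => T z z) q.1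
      (hasFDerivAt_quadratic T hT (x q)) hD).const_smul q.2)
  have hev : (fun y => x (y, q.2)) =ᶠ[𝓝 q.1]
      fun y => c y + q.2 • T (x (y, q.2)) (x (y, q.2)) := ht.eventually hq
  refine (hD.unique (hr.congr_of_eventuallyEq hev)).trans ?_
  ext v
  simp [mul_smul, smul_comm q.2 (2 : ℝ)]

/-- At q = 0 the linearized equation reads D = c, and D depends continuously on q. -/
lemma eventually_norm_quadratic_fixedPoint_deriv_sub_lt {c : Y →L[ℝ] X} {T : X →L[ℝ] X →L[ℝ] X}
    (hT : ∀ u v, T u v = T v u) {x : Y × ℝ → X} (hx : ContDiffAt ℝ ω x 0)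
    (heq : ∀ᶠ q in 𝓝 (0 : Y × ℝ), x q = c q.1 + q.2 • T (x q) (x q)) {ε : ℝ} (hε : 0 < ε) :
    ∀ᶠ q in 𝓝 (0 : Y × ℝ), ∃ D : Y →L[ℝ] X, HasFDerivAt (fun y => x (y, q.2)) D q.1 ∧
      D = c + (2 * q.2) • (T (x q)).comp D ∧ ‖D - c‖ < ε := by
  have hder := eventually_quadratic_fixedPoint_deriv hT hx heq
  have hDlim : Tendsto (fun q => (fderiv ℝ x q).comp (.inl ℝ Y ℝ)) (𝓝 0) (𝓝 c) := by
    have h1 : ContinuousAt (fun q => (fderiv ℝ x q).comp (.inl ℝ Y ℝ)) 0 :=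
      ((hx.fderiv_right (m := 0) (by simp)).continuousAt).clm_comp continuousAt_const
    obtain ⟨D, hD, -, hD'⟩ := hder.self_of_nhds
    have h2 : (fderiv ℝ x 0).comp (.inl ℝ Y ℝ) = c := by
      rw [← hD, hD']
      simp
    rwa [ContinuousAt, h2] at h1
  filter_upwards [hder, hDlim.eventually (Metric.ball_mem_nhds _ hε)] with q ⟨D, hD, h1, h2⟩ hq
  rw [← hD] at hq
  exact ⟨D, h1, h2, mem_ball_iff_norm.1 hq⟩

lemma eq_of_eq_add_smul_comp_zero {c D : Y →L[ℝ] X} {T : X →L[ℝ] X →L[ℝ] X} {t : ℝ}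
    (h : D = c + t • (T 0).comp D) : D = c := by
  rw [h]
  simp

end FixedPoint

/-! ### The integral equation of a quadratic field, on continuous paths. -/

section PathSpace

variable {E : Type*} [NormedAddCommGroup E] [NormedSpace ℝ E]

/-- The constant paths. -/
def constPath (E : Type*) [NormedAddCommGroup E] [NormedSpace ℝ E] :
    E →L[ℝ] C(Icc (0 : ℝ) 1, E) :=
  LinearMap.mkContinuous
    { toFun := fun v => ContinuousMap.const _ v
      map_add' := fun _ _ => rfl
      map_smul' := fun _ _ => rfl } 1 fun v => by
    rw [one_mul]
    exact (ContinuousMap.norm_le _ (norm_nonneg v)).2 fun _ => le_rfl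

/-- The primitive of a path which vanishes at time `0`. -/
def primitivePath (E : Type*) [NormedAddCommGroup E] [NormedSpace ℝ E] :
    C(Icc (0 : ℝ) 1, E) →L[ℝ] C(Icc (0 : ℝ) 1, E) :=
  LinearMap.mkContinuous
    { toFun := fun x => ⟨fun τ => ∫ s in (0 : ℝ)..τ, IccExtend zero_le_one x s,
        (intervalIntegral.continuous_primitive
          (fun _ _ => (x.continuous.Icc_extend').intervalIntegrable _ _) 0).comp
          continuous_subtype_val⟩
      map_add' := fun x y => by
        ext τ
        exact intervalIntegral.integral_add ((x.continuous.Icc_extend').intervalIntegrable _ _)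
          ((y.continuous.Icc_extend').intervalIntegrable _ _)
      map_smul' := fun a x => by
        ext τ
        exact intervalIntegral.integral_smul a _ } 1 fun x => by
    rw [one_mul]
    refine (ContinuousMap.norm_le _ (norm_nonneg x)).2 fun τ => ?_
    have h := intervalIntegral.norm_integral_le_of_norm_le_const (a := 0) (b := (τ : ℝ))
      (f := IccExtend zero_le_one x) (C := ‖x‖) fun s _ => x.norm_coe_le_norm _
    rw [sub_zero, abs_of_nonneg τ.2.1] at h
    exact h.trans (mul_le_of_le_one_right (norm_nonneg x) τ.2.2)

/-- The pointwise extension of a bilinear map to paths. -/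
def bilinPath (B : E →L[ℝ] E →L[ℝ] E) :
    C(Icc (0 : ℝ) 1, E) →L[ℝ] C(Icc (0 : ℝ) 1, E) →L[ℝ] C(Icc (0 : ℝ) 1, E) :=
  LinearMap.mkContinuous₂
    (LinearMap.mk₂ ℝ (fun x y => ⟨fun τ => B (x τ) (y τ),
        (B.continuous.comp x.continuous).clm_apply y.continuous⟩)
      (fun _ _ _ => by ext; simp) (fun _ _ _ => by ext; simp)
      (fun _ _ _ => by ext; simp) (fun _ _ _ => by ext; simp)) ‖B‖ fun x y => by
    refine (ContinuousMap.norm_le _ (by positivity)).2 fun τ => ?_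
    refine (B.le_opNorm₂ (x τ) (y τ)).trans ?_
    gcongr
    · exact x.norm_coe_le_norm τ
    · exact y.norm_coe_le_norm τ

/-- The bilinear operator of the integral equation attached to a quadratic vector field. -/
def integralOp (B : E →L[ℝ] E →L[ℝ] E) :
    C(Icc (0 : ℝ) 1, E) →L[ℝ] C(Icc (0 : ℝ) 1, E) →L[ℝ] C(Icc (0 : ℝ) 1, E) :=
  (ContinuousLinearMap.compL ℝ _ _ _ (primitivePath E)).comp (bilinPath B)

lemma integralOp_apply (B : E →L[ℝ] E →L[ℝ] E) (x y : C(Icc (0 : ℝ) 1, E)) (τ : Icc (0 : ℝ) 1) :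
    integralOp B x y τ = ∫ s in (0 : ℝ)..τ,
      B (IccExtend zero_le_one x s) (IccExtend zero_le_one y s) := rfl

lemma integralOp_symm {B : E →L[ℝ] E →L[ℝ] E} (hB : ∀ u v, B u v = B v u)
    (x y : C(Icc (0 : ℝ) 1, E)) : integralOp B x y = integralOp B y x := by
  ext τ
  simp only [integralOp_apply, hB]

/-- The evaluation of paths at a time. -/
abbrev evalPath (E : Type*) [NormedAddCommGroup E] [NormedSpace ℝ E] (τ : Icc (0 : ℝ) 1) :
    C(Icc (0 : ℝ) 1, E) →L[ℝ] E := ContinuousMap.evalCLM ℝ τ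

lemma norm_evalPath_comp_sub_one_le (D : E →L[ℝ] C(Icc (0 : ℝ) 1, E)) (τ : Icc (0 : ℝ) 1) :
    ‖(evalPath E τ).comp D - 1‖ ≤ ‖D - constPath E‖ := by
  refine ContinuousLinearMap.opNorm_le_bound _ (ContinuousLinearMap.opNorm_nonneg _) fun v => ?_
  refine le_trans ?_ ((D - constPath E).le_opNorm v)
  exact ((D - constPath E) v).norm_coe_le_norm τ

lemma norm_smul_IccExtend_le (B : E →L[ℝ] E →L[ℝ] E) (x : C(Icc (0 : ℝ) 1, E)) (t τ : ℝ) :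
    ‖t • B (IccExtend zero_le_one x τ)‖ ≤ ‖t‖ * (‖B‖ * ‖x‖) := by
  rw [norm_smul]
  gcongr
  refine (B.le_opNorm _).trans ?_
  gcongr
  exact x.norm_coe_le_norm _

/-- The differential of the solution of the integral equation solves the linearized equation. -/
lemma exists_linearized_solution [FiniteDimensional ℝ E] {B : E →L[ℝ] E →L[ℝ] E}
    {x : C(Icc (0 : ℝ) 1, E)} {D : E →L[ℝ] C(Icc (0 : ℝ) 1, E)} {t : ℝ}
    (hD : D = constPath E + (2 * t) • (integralOp B x).comp D) :
    ∃ M : ℝ → E →L[ℝ] E, M 0 = 1 ∧ (∀ τ : Icc (0 : ℝ) 1, M τ = (evalPath E τ).comp D) ∧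
      ∀ τ, τ ∈ Icc (0 : ℝ) 1 →
        HasDerivAt M (((2 * t) • B (IccExtend zero_le_one x τ)) * M τ) τ := by
  let m : ℝ → E →L[ℝ] E := fun s => (evalPath E (projIcc 0 1 zero_le_one s)).comp D
  have hm : Continuous m := by
    rw [continuous_clm_apply]
    intro v
    exact (D v).continuous.comp continuous_projIcc
  let N : ℝ → E →L[ℝ] E := fun s => ((2 * t) • B (IccExtend zero_le_one x s)) * m s
  have hN : Continuous N :=
    ((B.continuous.comp x.continuous.Icc_extend').const_smul (2 * t)).mul hm
  have heq : ∀ τ : Icc (0 : ℝ) 1, 1 + ∫ s in (0 : ℝ)..τ, N s = (evalPath E τ).comp D := by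
    intro τ
    ext1 v
    have h1 : (evalPath E τ).comp D v =
        v + (2 * t) • ∫ s in (0 : ℝ)..τ, B (IccExtend zero_le_one x s) (m s v) := by
      have h := congrArg (fun L : E →L[ℝ] C(Icc (0 : ℝ) 1, E) => L v τ) hD
      exact h
    rw [h1, ← intervalIntegral.integral_smul]
    change v + (∫ s in (0 : ℝ)..τ, N s) v = _
    rw [ContinuousLinearMap.intervalIntegral_apply (hN.intervalIntegrable _ _)]
    rfl
  -- The integrand is extended beyond [0, 1], which makes the derivative two-sided at the endpoints
  -- too.
  refine ⟨fun τ => 1 + ∫ s in (0 : ℝ)..τ, N s, by simp, heq, fun τ hτ => ?_⟩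
  have hd : HasDerivAt (fun τ => 1 + ∫ s in (0 : ℝ)..τ, N s) (N τ) τ :=
    (hN.integral_hasStrictDerivAt 0 τ).hasDerivAt.const_add 1
  convert hd using 1
  have h1 := heq ⟨τ, hτ⟩
  simp only [N, m, projIcc_of_mem zero_le_one hτ]
  rw [← h1]

end PathSpace

/-! ### The flow of a quadratic field in the prolongation. -/

variable {p : ℕ}

/-- A quadratic vector field with differentials in the Lie algebra of `G` has a local flow, with
differentials in `G`, which is not linear at small nonzero times unless the field vanishes. -/
theorem exists_quadratic_flow {G : Subgroup (GL (Fin p) ℝ)} {d : ℕ} (Λ : LocalParam G d)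
    {B : (Fin p → ℝ) →L[ℝ] (Fin p → ℝ) →L[ℝ] (Fin p → ℝ)} (hB : ∀ u v, B u v = B v u)
    (hBG : ∀ v, B v ∈ lieAlgCLM G) :
    ∃ ψ : (Fin p → ℝ) × ℝ → (Fin p → ℝ),
      (∀ᶠ q in 𝓝 (0 : (Fin p → ℝ) × ℝ), ContDiffAt ℝ ω ψ q ∧
        fderiv ℝ (fun y => ψ (y, q.2)) q.1 ∈ clmSet G ∧ ψ (0, q.2) = 0 ∧
        (q.2 = 0 → ψ q = q.1)) ∧
      ∀ᶠ t in 𝓝 (0 : ℝ), t ≠ 0 → ∀ L : (Fin p → ℝ) →L[ℝ] (Fin p → ℝ),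
        (fun y => ψ (y, t)) =ᶠ[𝓝 0] L → B = 0 := by
  -- x(y, t) is the path on [0, 1] solving z' = tB(z, z), z(0) = y; its endpoint is the flow at time
  -- t. Smoothness in (y, t) comes with the fixed point.
  obtain ⟨x, hx, hxeq⟩ := exists_quadratic_fixedPoint (constPath (Fin p → ℝ)) (integralOp B)
  obtain ⟨ε, hε, hode⟩ := Λ.exists_forall_ode_mem
  have hder := eventually_norm_quadratic_fixedPoint_deriv_sub_lt (integralOp_symm hB) hx
    (hxeq.mono fun q hq => hq.1) hε
  let one : Icc (0 : ℝ) 1 := ⟨1, zero_le_one, le_rfl⟩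
  let ev := evalPath (Fin p → ℝ) one
  have hxω : ∀ᶠ q in 𝓝 (0 : (Fin p → ℝ) × ℝ), ContDiffAt ℝ ω x q := hx.eventually (by simp)
  have hsmall : ∀ᶠ q in 𝓝 (0 : (Fin p → ℝ) × ℝ), ‖2 * q.2‖ * (‖B‖ * ‖x q‖) < 1 := by
    have h1 : ContinuousAt (fun q : (Fin p → ℝ) × ℝ => ‖2 * q.2‖ * (‖B‖ * ‖x q‖)) 0 :=
      (by fun_prop : ContinuousAt (fun q : (Fin p → ℝ) × ℝ => ‖2 * q.2‖) 0).mul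
        (continuousAt_const.mul hx.continuousAt.norm)
    exact h1.eventually (gt_mem_nhds (by simp))
  have hfd : ∀ᶠ q in 𝓝 (0 : (Fin p → ℝ) × ℝ), ∃ D : (Fin p → ℝ) →L[ℝ] C(Icc (0 : ℝ) 1, Fin p → ℝ),
      HasFDerivAt (fun y => x (y, q.2)) D q.1 ∧
      D = constPath _ + (2 * q.2) • (integralOp B (x q)).comp D ∧ ev.comp D ∈ clmSet G := by
    filter_upwards [hder, hsmall] with q ⟨D, hD, hDeq, hDε⟩ hs
    refine ⟨D, hD, hDeq, ?_⟩
    obtain ⟨M, hM0, hM, hMd⟩ := exists_linearized_solution hDeq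
    -- The Jacobian of the flow solves M' = 2tB(x, ·)M, with coefficient in 𝔤 and of norm below 1
    -- for small q, while M stays near 1.
    have hres := hode M (fun τ => (2 * q.2) • B (IccExtend zero_le_one (x q) τ)) (fun τ hτ => ?_) hM0
    · rw [hM one] at hres
      exact hres
    · refine ⟨Submodule.smul_mem _ _ (hBG _), (norm_smul_IccExtend_le B _ _ τ).trans hs.le, ?_,
        hMd τ hτ⟩
      rw [hM ⟨τ, hτ⟩]
      exact (norm_evalPath_comp_sub_one_le D _).trans_lt hDε
  refine ⟨fun q => ev (x q), ?_, ?_⟩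
  · filter_upwards [hxω, hfd, hxeq] with q hq1 ⟨D, hD, _, hDG⟩ hq3
    refine ⟨ev.contDiff.contDiffAt.comp q hq1, ?_, ?_, fun h => ?_⟩
    · have h := (ev.hasFDerivAt.comp q.1 hD).fderiv
      exact h ▸ hDG
    · simp only [hq3.2, map_zero]
    · have h1 := hq3.1
      rw [h, zero_smul, add_zero] at h1
      simp only [h1]
      rfl
  · have ht : Tendsto (fun t : ℝ => ((0 : Fin p → ℝ), t)) (𝓝 0) (𝓝 0) :=
      (Continuous.prodMk_right (0 : Fin p → ℝ)).tendsto' _ _ rfl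
    filter_upwards [ht.eventually hxeq.eventually_nhds, ht.eventually hfd] with
      t ht1 ⟨D, hD, hDeq, _⟩ ht0 L hL
    have hx0t : x (0, t) = 0 := ht1.self_of_nhds.2
    have hDc : D = constPath _ := eq_of_eq_add_smul_comp_zero (hx0t ▸ hDeq)
    rw [hDc] at hD
    have hL1 : L = 1 := by
      have h1 := (ev.hasFDerivAt.comp (0 : Fin p → ℝ) hD).unique
        (L.hasFDerivAt.congr_of_eventuallyEq hL)
      rw [← h1]
      rfl
    have hy : Tendsto (fun y : Fin p → ℝ => (y, t)) (𝓝 0) (𝓝 (0, t)) :=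
      (Continuous.prodMk_left t).tendsto' _ _ rfl
    -- The flow has derivative 1 at 0, so a linear flow is the identity; for t ≠ 0 the integral term
    -- must vanish.
    have hzero : ∀ᶠ y in 𝓝 (0 : Fin p → ℝ), ev (integralOp B (x (y, t)) (x (y, t))) = 0 := by
      filter_upwards [hy.eventually ht1, hL] with y h1 h2
      have h3 := h1.1
      have h4 : ev (x (y, t)) = y + t • ev (integralOp B (x (y, t)) (x (y, t))) := by
        conv_lhs => rw [h3]
        rw [map_add, map_smul]
        rfl
      rw [hL1] at h2
      have h5 : y + t • ev (integralOp B (x (y, t)) (x (y, t))) = y + 0 := by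
        rw [← h4, add_zero]
        exact h2
      exact (smul_eq_zero.1 (add_left_cancel h5)).resolve_left ht0
    refine eq_zero_of_quadratic_eq_zero B hB fun v => ?_
    have hl : HasDerivAt (fun s : ℝ => s • v) v 0 := by
      simpa using (hasDerivAt_id (0 : ℝ)).smul_const v
    have hline : HasDerivAt (fun s : ℝ => x (s • v, t)) (constPath _ v) 0 := by
      refine HasFDerivAt.comp_hasDerivAt (l := fun y => x (y, t)) (0 : ℝ) ?_ hl
      rw [zero_smul]
      exact hD
    -- Rescaling: x(sv, t)/s tends to the constant path v. The integral term is homogeneous of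
    -- degree two, so its vanishing passes to the limit and gives B(v, v) = 0.
    have hslope := hline.tendsto_slope_zero
    simp only [zero_add, zero_smul, hx0t, sub_zero] at hslope
    have hQ : Continuous fun z => ev (integralOp B z z) :=
      ev.continuous.comp ((integralOp B).continuous.clm_apply continuous_id)
    have hlim := (hQ.tendsto _).comp hslope
    have hlim0 : Tendsto ((fun z => ev (integralOp B z z)) ∘ fun s : ℝ => s⁻¹ • x (s • v, t))
        (𝓝[≠] 0) (𝓝 0) := by
      refine tendsto_const_nhds.congr' ?_
      have hs : Tendsto (fun s : ℝ => s • v) (𝓝[≠] 0) (𝓝 0) := by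
        have := hl.continuousAt.tendsto
        rw [zero_smul] at this
        exact this.mono_left nhdsWithin_le_nhds
      filter_upwards [hs.eventually hzero] with s hs
      simp [hs]
    have h1 := tendsto_nhds_unique hlim hlim0
    have h2 : ev (integralOp B (constPath _ v) (constPath _ v)) = B v v := by
      change ∫ s in (0 : ℝ)..1, B v v = B v v
      simp
    rwa [h2] at h1

/-! ### Diffeomorphism germs and the group inside Diff_0[G]. -/

/-- Being `ContDiffAt` of class ω at a point is an open condition, unlike class ∞; this is why the
flow is built in class ω. -/
lemma eventually_contDiffAt_infty {U V : Type*} [NormedAddCommGroup U] [NormedSpace ℝ U]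
    [NormedAddCommGroup V] [NormedSpace ℝ V] {f : U → V} {x : U} (h : ContDiffAt ℝ ω f x) :
    ∀ᶠ y in 𝓝 x, ContDiffAt ℝ ∞ f y :=
  (h.eventually (by simp)).mono fun _ hy => hy.of_le le_top

/-- The inverse function theorem for analytic germs. -/
lemma isDiffeoGerm_of_contDiffAt {f : (Fin p → ℝ) → (Fin p → ℝ)} (h0 : f 0 = 0)
    (hf : ContDiffAt ℝ ω f 0) {A : GL (Fin p) ℝ} (hA : fderiv ℝ f 0 = glCLM A) :
    IsDiffeoGerm f := by
  let e : (Fin p → ℝ) ≃L[ℝ] (Fin p → ℝ) :=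
    ContinuousLinearEquiv.equivOfInverse (glCLM A) (glCLM A⁻¹)
      (fun v => congrArg (fun L : (Fin p → ℝ) →L[ℝ] (Fin p → ℝ) => L v) (glCLM_inv_mul A))
      (fun v => congrArg (fun L : (Fin p → ℝ) →L[ℝ] (Fin p → ℝ) => L v) (glCLM_mul_inv A))
  have hd : HasFDerivAt f (e : (Fin p → ℝ) →L[ℝ] (Fin p → ℝ)) 0 := by
    have h := (hf.differentiableAt (by simp)).hasFDerivAt
    rw [hA] at h
    exact h
  have hs := hf.hasStrictFDerivAt' hd (by simp)
  have hg := hf.to_localInverse hd (by simp)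
  have h1 := hf.localInverse_apply_image hd (by simp)
  have h2 := hs.eventually_right_inverse
  rw [h0] at hg h1 h2
  exact ⟨h0, eventually_contDiffAt_infty hf, hf.localInverse hd (by simp), h1,
    eventually_contDiffAt_infty hg, hs.eventually_left_inverse, h2⟩

lemma mem_diffG_of_contDiffAt {G : Subgroup (GL (Fin p) ℝ)} {f : (Fin p → ℝ) → (Fin p → ℝ)}
    (h0 : f 0 = 0) (hf : ContDiffAt ℝ ω f 0) (hG : ∀ᶠ y in 𝓝 0, fderiv ℝ f y ∈ clmSet G) :
    (f : MapGerm p) ∈ DiffG G := by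
  obtain ⟨A, -, hA⟩ := mem_clmSet.1 hG.self_of_nhds
  exact ⟨f, rfl, isDiffeoGerm_of_contDiffAt h0 hf hA.symm, hG⟩

lemma linear_mem_diffG {G : Subgroup (GL (Fin p) ℝ)} {L : (Fin p → ℝ) →L[ℝ] (Fin p → ℝ)}
    (hL : L ∈ clmSet G) : ((fun y => L y : (Fin p → ℝ) → (Fin p → ℝ)) : MapGerm p) ∈ DiffG G :=
  mem_diffG_of_contDiffAt (map_zero L) L.contDiff.contDiffAt
    (Eventually.of_forall fun y => by rwa [L.fderiv])

/-- A smooth path c in G from 1 to A gives the isotopy (y, t) ↦ c(t)y. -/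
lemma LocalParam.linGerm_image_subset {G : Subgroup (GL (Fin p) ℝ)} {d : ℕ}
    (Λ : LocalParam G d) : linGerm '' (G : Set (GL (Fin p) ℝ)) ⊆ Diff0G G := by
  rintro _ ⟨A, hA, rfl⟩
  obtain ⟨c, hc, hcG, hc0, hc1⟩ := Λ.exists_path hA
  rw [linGerm_eq]
  refine ⟨linear_mem_diffG (glCLM_mem_clmSet.2 hA), fun q => c q.2 q.1, ?_, ?_, ?_, ?_⟩
  · exact Eventually.of_forall fun q =>
      ((hc.comp contDiff_snd).clm_apply contDiff_fst).contDiffAt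
  · exact fun t _ => linear_mem_diffG (hcG t)
  · simp only [hc0]
    rfl
  · simp only [hc1]

/-- The flow of B(y, y), slowed down by a small factor s, is an isotopy in Diff[G]. Its end map is
linear by hypothesis, which forces B = 0. -/
lemma LocalParam.prolongationEqZero_of_diff0G_eq {G : Subgroup (GL (Fin p) ℝ)} {d : ℕ}
    (Λ : LocalParam G d) (h : Diff0G G ⊆ linGerm '' (G : Set (GL (Fin p) ℝ))) :
    ProlongationEqZero G := by
  intro B hB hBG
  obtain ⟨ψ, hψ, hlin⟩ := exists_quadratic_flow Λ hB hBG
  obtain ⟨ε, hε, hball⟩ := Metric.eventually_nhds_iff_ball.1 hψ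
  obtain ⟨δ, hδ, hlin⟩ := Metric.eventually_nhds_iff_ball.1 hlin
  have hmin : 0 < min ε δ := lt_min hε hδ
  -- Strictly below both radii: st stays in the domain of the flow for t ∈ [0, 1], and s is a time
  -- at which linearity forces B = 0.
  let s := min ε δ / 2
  have hs : 0 < s := half_pos hmin
  have hsmin : s < min ε δ := half_lt_self hmin
  have hmem : ∀ t ∈ Icc (0 : ℝ) 1, ((0 : Fin p → ℝ), s * t) ∈ Metric.ball (0 : (Fin p → ℝ) × ℝ) ε := by
    intro t ht
    rw [mem_ball_zero_iff, Prod.norm_mk, norm_zero, Real.norm_of_nonneg (mul_nonneg hs.le ht.1)]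
    refine max_lt hε ?_
    exact (mul_le_of_le_one_right hs.le ht.2).trans_lt (hsmin.trans_le (min_le_left _ _))
  have hdiff : ∀ t ∈ Icc (0 : ℝ) 1,
      ((fun y => ψ (y, s * t) : (Fin p → ℝ) → (Fin p → ℝ)) : MapGerm p) ∈ DiffG G := by
    intro t ht
    obtain ⟨h1, -, h3, -⟩ := hball _ (hmem t ht)
    have hpair : ContDiff ℝ ω fun y : Fin p → ℝ => (y, s * t) := contDiff_id.prodMk contDiff_const
    refine mem_diffG_of_contDiffAt h3 (ContDiffAt.comp (g := ψ) 0 h1 hpair.contDiffAt) ?_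
    filter_upwards [hpair.continuous.continuousAt.preimage_mem_nhds
      (Metric.isOpen_ball.mem_nhds (hmem t ht))] with y hy
    exact (hball _ hy).2.1
  have hone : (1 : ℝ) ∈ Icc (0 : ℝ) 1 := ⟨zero_le_one, le_rfl⟩
  have hzero : (0 : ℝ) ∈ Icc (0 : ℝ) 1 := ⟨le_rfl, zero_le_one⟩
  have hscale : ContDiff ℝ ∞ fun q : (Fin p → ℝ) × ℝ => (q.1, s * q.2) :=
    contDiff_fst.prodMk (contDiff_const.mul contDiff_snd)
  have hψ0 : ((fun y => ψ (y, s * 1) : (Fin p → ℝ) → (Fin p → ℝ)) : MapGerm p) ∈ Diff0G G := by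
    refine ⟨hdiff 1 hone, fun q => ψ (q.1, s * q.2), ?_, hdiff, ?_, rfl⟩
    · have hopen : IsOpen ((fun q : (Fin p → ℝ) × ℝ => (q.1, s * q.2)) ⁻¹' Metric.ball 0 ε) :=
        Metric.isOpen_ball.preimage hscale.continuous
      refine mem_of_superset (hopen.mem_nhdsSet.2 ?_) fun q hq => ?_
      · rintro ⟨y, t⟩ ⟨rfl, ht⟩
        exact hmem t ht
      · exact ContDiffAt.comp (g := ψ) q ((hball _ hq).1.of_le le_top) hscale.contDiffAt
    · refine Germ.coe_eq.2 ?_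
      have hpair : Continuous fun y : Fin p → ℝ => (y, s * 0) := by fun_prop
      filter_upwards [hpair.continuousAt.preimage_mem_nhds
        (Metric.isOpen_ball.mem_nhds (hmem 0 hzero))] with y hy
      exact (hball _ hy).2.2.2 (mul_zero s)
  obtain ⟨A, -, hA⟩ := h hψ0
  rw [linGerm_eq, mul_one] at hA
  refine hlin s ?_ hs.ne' (glCLM A) (Germ.coe_eq.1 hA).symm
  rw [mem_ball_zero_iff, Real.norm_of_nonneg hs.le]
  exact hsmin.trans_le (min_le_right _ _)

end GDiff
end

/-- In (3), `G` is regarded as a set of diffeomorphism germs through `A ↦ ψ_A`. -/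
theorem theorem7p1 (p : ℕ) (G : Subgroup (GL (Fin p) ℝ))
    (hG : GDiff.IsConnectedLinearLieGroup G) :
    List.TFAE [
      Nonempty (GDiff.lieAlg G ≃ₗ[ℝ] GDiff.theta0 G),
      ∀ η ∈ GDiff.theta0 G, ∀ i : Fin p, ∃ ℓ : (Fin p → ℝ) →ₗ[ℝ] ℝ,
        Filter.Germ.map (fun v : Fin p → ℝ => v i) η =
          ((fun y => ℓ y : (Fin p → ℝ) → ℝ) : Filter.Germ (𝓝 (0 : Fin p → ℝ)) ℝ),
      GDiff.Diff0G G = GDiff.linGerm '' (G : Set (GL (Fin p) ℝ))] := by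
  obtain ⟨d, ⟨Λ⟩⟩ := hG.exists_localParam
  tfae_have 1 ↔ 2 := GDiff.allFieldsLinear_iff_nonempty_equiv G
  tfae_have 2 → 3 := fun h => Subset.antisymm
    (fun _ hψ => (GDiff.AllFieldsLinear.prolongationEqZero h).diffG_subset hψ.1)
    Λ.linGerm_image_subset
  tfae_have 3 → 2 := fun h => (Λ.prolongationEqZero_of_diff0G_eq h.subset).allFieldsLinear
  tfae_finish
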